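/- Let $0<s_1<s_2$, $v>0$, $v_b>0$. For $m\in\mathbb N$ and $N=4m+1$ consider a chain of $N$ resonators $D_i=(x_i^L,x_i^R)\subset\mathbb R$ of unit length, with $x_1^L=0$ and spacings $x_{i+1}^L-x_i^R$, $1\le i\le N-1$, equal to $s_1,s_2,s_1,s_2,\dots,s_1,s_2$ ($2m$ terms) followed by $s_2,s_1,s_2,s_1,\dots,s_2,s_1$ ($2m$ terms), so that the chain is symmetric about the midpoint $x_0$ of the middle resonator $D_{2m+1}$ (the geometric defect). Put $D=\bigcup_i D_i$. For a density contrast $\delta>0$ and $\omega\in\mathbb C$ consider continuous solutions $u:\mathbb R\to\mathbb C$ of $$u''+\frac{\omega^2}{v_b^2}u=0\ \text{ in } D,\qquad u''+\frac{\omega^2}{v^2}u=0\ \text{ in }\mathbb R\setminus\overline D,$$ $$u'(x_i^L+)=\delta\,u'(x_i^L-),\qquad \delta\,u'(x_i^R+)=u'(x_i^R-)\quad(1\le i\le N),\qquad \frac{du}{d|x|}-\mathrm i\frac{\omega}{v}u=0\ \text{ on }(-\infty,x_1^L)\cup(x_N^R,\infty).$$ A subwavelength eigenfrequency is a family $\omega(\delta)\in\mathbb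 C$, given for small $\delta>0$ up to equality near $\delta=0$, with $\operatorname{Re}\omega(\delta)\ge 0$ and $\omega(\delta)\to0$ as $\delta\to0$, for which this system has a nonzero solution (an eigenmode). If $\omega(\delta)/\sqrt\delta\to v_b\sqrt\lambda$ as $\delta\to 0$ with $\lambda>0$, then $v_b\sqrt{\delta\lambda}$ is the eigenfrequency at leading order, and the eigenfrequency is said to lie in the band gap if $\lambda\in\Gamma:=(2/s_2,2/s_1)$. Let $C$ be the capacitance matrix of the chain, the symmetric tridiagonal $N\times N$ matrix with $C_{i,i+1}=C_{i+1,i}=-1/(x_{i+1}^L-x_i^R)$ and zero row sums. Theorem. There are $M\in\mathbb N$ and $K,\kappa>0$ such that for every $m\ge M$: 1. $C$ has exactly one eigenvalue $\lambda^{(N)}$ in $\Gamma$. Its eigenspace is one-dimensional, and each of its eigenvectors $a$ is localised at the interface: $|a_i|\le K e^{-\kappa|i-(2m+1)|}\,|a_{2m+1}|$ for all $1\le i\le N$. 2. There is exactly one subwavelength eigenfrequency $\omega^{(N)}(\delta)$ that lies in the band gap, and $\omega^{(N)}(\delta)=v_b\sqrt{\delta\lambda^{(N)}}+O(\delta)$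 as $\delta\to0$ (for fixed $N$). For all sufficiently small $\delta>0$ (depending on $N$) its eigenmode $u$ is unique up to a constant factor and is localised at the interface: $|u(x)|\le K e^{-\kappa|x-x_0|}|u(x_0)|$ for all $x\in D$. Moreover, for every $\delta>0$ the eigenfrequency at leading order, $\omega_{\mathsf i}^{(N)}=v_b\sqrt{\delta\lambda^{(N)}}$, converges as $N\to\infty$ to $$\omega_{\mathsf i}=v_b\sqrt{\delta\,\frac12\left(\frac3{s_1}+\frac3{s_2}-\sqrt{\frac9{s_1^2}-\frac{14}{s_1s_2}+\frac9{s_2^2}}\right)},$$ and there are $A,B>0$ independent of $N$ with $|\omega_{\mathsf i}-\omega_{\mathsf i}^{(N)}|<A e^{-BN}$ for all $N=4m+1$ with $m\ge M$. -/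

import Mathlib

open Filter Topology Set

noncomputable section

namespace DimerChain

/-! ### Geometry of a chain of resonators of unit length

Resonators and spacings are numbered from `1`, and `s i` is the distance between the `i`-th and the
`(i+1)`-st resonator. Only `s 1, …, s (N-1)` matter for a chain of `N` resonators. -/

/-- Left end of the `i`-th resonator; the first resonator starts at `0`. -/
def leftEnd (s : ℕ → ℝ) (i : ℕ) : ℝ := ∑ j ∈ Finset.Ico 1 i, (1 + s j)

/-- Right end of the `i`-th resonator. -/
def rightEnd (s : ℕ → ℝ) (i : ℕ) : ℝ := leftEnd s i + 1

/-- The union `D` of the `N` (open) resonators. -/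
def resonators (s : ℕ → ℝ) (N : ℕ) : Set ℝ :=
  ⋃ i ∈ Finset.Icc 1 N, Ioo (leftEnd s i) (rightEnd s i)

/-- The union of the closed intervals occupied by the `N` resonators. -/
def closedResonators (s : ℕ → ℝ) (N : ℕ) : Set ℝ :=
  ⋃ i ∈ Finset.Icc 1 N, Icc (leftEnd s i) (rightEnd s i)

/-- Spacings of the chain of `4 m + 1` dimerised resonators with a geometric defect:
`s₁, s₂, s₁, s₂, …, s₁, s₂` (the first `2 m` of them), then `s₂, s₁, s₂, s₁, …, s₂, s₁`. -/
def defectSpacing (m : ℕ) (s₁ s₂ : ℝ) (i : ℕ) : ℝ :=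
  if i ≤ 2 * m then (if Odd i then s₁ else s₂) else (if Odd i then s₂ else s₁)

/-- The midpoint of the middle resonator (number `2 m + 1`), where the defect sits. -/
def interfacePoint (m : ℕ) (s₁ s₂ : ℝ) : ℝ :=
  leftEnd (defectSpacing m s₁ s₂) (2 * m + 1) + 1 / 2

/-! ### The Helmholtz scattering problem -/

/-- `u` solves the system of coupled Helmholtz equations at the frequency `ω` for the chain with
spacings `s`, wave speeds `vb` inside the resonators and `v` outside, and density contrast `δ`,
with the outgoing radiation condition. -/
structure IsSolution (s : ℕ → ℝ) (N : ℕ) (v vb δ : ℝ) (ω : ℂ) (u : ℝ → ℂ) : Prop where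
  continuous : Continuous u
  inside : ∀ x ∈ resonators s N,
    DifferentiableAt ℝ u x ∧ HasDerivAt (deriv u) (-(ω ^ 2 / (vb : ℂ) ^ 2) * u x) x
  outside : ∀ x ∉ closedResonators s N,
    DifferentiableAt ℝ u x ∧ HasDerivAt (deriv u) (-(ω ^ 2 / (v : ℂ) ^ 2) * u x) x
  flux_left : ∀ i ∈ Finset.Icc 1 N, ∃ p q : ℂ,
    Tendsto (deriv u) (𝓝[<] leftEnd s i) (𝓝 p) ∧
    Tendsto (deriv u) (𝓝[>] leftEnd s i) (𝓝 q) ∧ q = δ * p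
  flux_right : ∀ i ∈ Finset.Icc 1 N, ∃ p q : ℂ,
    Tendsto (deriv u) (𝓝[<] rightEnd s i) (𝓝 p) ∧
    Tendsto (deriv u) (𝓝[>] rightEnd s i) (𝓝 q) ∧ δ * q = p
  radiation_left : ∀ x < leftEnd s 1, -deriv u x - Complex.I * (ω / v) * u x = 0
  radiation_right : ∀ x > rightEnd s N, deriv u x - Complex.I * (ω / v) * u x = 0

/-- A subwavelength eigenfrequency: a family `ω δ` of frequencies, for all small contrasts `δ > 0`,
with nonnegative real part, that tends to `0` as `δ → 0` and for which the scattering problem has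
a nonzero solution. Families are to be compared near `δ = 0` only. -/
structure IsSubwavelengthEigenfrequency (s : ℕ → ℝ) (N : ℕ) (v vb : ℝ) (ω : ℝ → ℂ) : Prop where
  tendsto_zero : Tendsto ω (𝓝[>] 0) (𝓝 0)
  re_nonneg : ∀ᶠ δ in 𝓝[>] (0 : ℝ), 0 ≤ (ω δ).re
  exists_mode : ∀ᶠ δ in 𝓝[>] (0 : ℝ), ∃ u : ℝ → ℂ, u ≠ 0 ∧ IsSolution s N v vb δ (ω δ) u

/-- Exponential decay of `u` on `D` away from the point `x₀`, with constants `K` and `κ`. -/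
def IsLocalisedAt (K κ x₀ : ℝ) (D : Set ℝ) (u : ℝ → ℂ) : Prop :=
  ∀ x ∈ D, ‖u x‖ ≤ K * Real.exp (-κ * |x - x₀|) * ‖u x₀‖

/-! ### The capacitance matrix -/

/-- `1 / s j`, with the convention that it is `0` unless `1 ≤ j ≤ N - 1`. -/
def invSpacing (s : ℕ → ℝ) (N j : ℕ) : ℝ := if 1 ≤ j ∧ j < N then (s j)⁻¹ else 0

/-- The tridiagonal capacitance matrix of a chain of `N` resonators. The row `i : Fin N` belongs to
the resonator number `i + 1`. -/
def capacitanceMatrix (s : ℕ → ℝ) (N : ℕ) : Matrix (Fin N) (Fin N) ℝ := fun i j =>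
  if (i : ℕ) = j then invSpacing s N i + invSpacing s N (i + 1)
  else if (j : ℕ) = i + 1 then -invSpacing s N j
  else if (i : ℕ) = j + 1 then -invSpacing s N i
  else 0

/-- The asymptotic spectral gap `(2 / s₂, 2 / s₁)` of the infinite periodic chain of dimers. -/
def bandGap (s₁ s₂ : ℝ) : Set ℝ := Ioo (2 / s₂) (2 / s₁)

/-- The frequency `v_b √(δ λ)` that belongs, at leading order in `δ`, to an eigenvalue `λ` of the
capacitance matrix. -/
def leadingFrequency (vb δ lam : ℝ) : ℝ := vb * √(δ * lam)

end DimerChain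

end

open DimerChain

/-!
The argument reduces everything to a shooting problem for pairs (value, exterior slope).

*Capacitance matrix.* The equation `C a = l a` says that the flux `y` through the spacings drops by
`l a_i` across the resonator `i`, so its solutions are multiples of `chainState`, shot from the left
end with zero flux and first entry `1`, and `l` is an eigenvalue if and only if the flux behind the last resonator
vanishes (`capacitanceMatrix_mulVec_eq_smul_iff`). For `l` in the band gap, the transfer matrix of a
dimer, taken between midpoints of successive spacings `s₂`, has only negative entries and half trace
below `-1`. Hence the shot solution grows exponentially towards the interface and does not vanish
there. By mirror symmetry, `l` is an eigenvalue if and only if the fluxes on the two sides of the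
middle resonator are opposite, that is `2 y = l a` there (`chainState_end_eq_zero_iff`). The discrete
Green identity makes `y / a` strictly decreasing in `l`, so there is at most one root
(`center_unique`). The transfer matrix preserves a quadratic form, and eliminating `y` with it turns
`2 y = l a` into a quadratic equation for `l`, whose smaller root is the limiting eigenvalue, up to
a term of order `1 / a ^ 2`; this gives existence and exponential convergence
(`exists_matching_root`).

*Scattering problem.* With `ε = √δ` and `ω = ε ζ`, the value and the exterior slope of the solution
that is outgoing on the left are analytic functions of `(ε, ζ)`, also at `ε = 0`, where they reduce
to `chainState` at `l = (ζ / vb) ^ 2`. Every solution of the scattering problem is a multiple of this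
one (`IsSolution.eq_smul_shotMode`), and it is a mode if and only if it is outgoing on the right,
which is one analytic equation `charFn = 0`. Eigenvalues of `C` are simple zeros of `charFn` at
`ε = 0`, again by the Green identity, so the implicit function theorem yields the eigenfrequency
together with its local uniqueness and its expansion (`exists_eigenfrequency`). As `δ → 0`, the mode
converges uniformly on the resonators to the constants given by the eigenvector of `C`, and inherits
its localisation (`isLocalisedAt_of_close`).
-/

namespace DimerChain

/-! ### The discrete shooting problem -/

/-- The solution of the capacitance equations at the spectral parameter `lam`, shot from the left
end of the chain: `(chainState s lam n).1` is the entry of resonator `n + 1`, normalised to be `1`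
for the first resonator, and `(chainState s lam n).2` is the flux (difference quotient) in the
spacing to the left of it. A chain of `N` resonators has the eigenvalue `lam` if and only if the
flux `(chainState s lam N).2` behind its last resonator vanishes. -/
def chainState {R : Type*} [CommRing R] (s : ℕ → R) (lam : R) : ℕ → R × R
  | 0 => (1, 0)
  | n + 1 => ((chainState s lam n).1
      + s (n + 1) * ((chainState s lam n).2 - lam * (chainState s lam n).1),
      (chainState s lam n).2 - lam * (chainState s lam n).1)

section Ring

variable {R : Type*} [CommRing R] (s : ℕ → R) (lam : R)

@[simp] lemma chainState_zero : chainState s lam 0 = (1, 0) := rfl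

lemma chainState_succ_snd (n : ℕ) : (chainState s lam (n + 1)).2
    = (chainState s lam n).2 - lam * (chainState s lam n).1 := rfl

lemma chainState_succ_fst (n : ℕ) : (chainState s lam (n + 1)).1
    = (chainState s lam n).1 + s (n + 1) * (chainState s lam (n + 1)).2 := rfl

lemma chainState_map {S : Type*} [CommRing S] (f : R →+* S) (n : ℕ) :
    chainState (fun i => f (s i)) (f lam) n
      = (f (chainState s lam n).1, f (chainState s lam n).2) := by
  induction n with
  | zero => simp
  | succ n ih => simp [chainState, ih]

/-- In a mirror-symmetric chain, the two halves match at the middle resonator `2 m + 1` if the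
fluxes on its two sides are opposite; then the flux behind the last resonator vanishes. -/
lemma chainState_symm_of_center {m : ℕ} (hs : ∀ i, 1 ≤ i → i ≤ 4 * m → s (4 * m + 1 - i) = s i)
    (h : 2 * (chainState s lam (2 * m)).2 = lam * (chainState s lam (2 * m)).1) :
    ∀ j ≤ 2 * m, (chainState s lam (2 * m + j)).1 = (chainState s lam (2 * m - j)).1 ∧
      (chainState s lam (2 * m + j + 1)).2 = -(chainState s lam (2 * m - j)).2 := by
  intro j
  induction j with
  | zero =>
    intro _
    refine ⟨rfl, ?_⟩
    simp only [Nat.add_zero, Nat.sub_zero, chainState_succ_snd]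
    linear_combination h
  | succ j ih =>
    intro hj
    obtain ⟨h1, h2⟩ := ih (by omega)
    obtain ⟨k, hk⟩ : ∃ k, 2 * m - j = k + 1 := ⟨2 * m - j - 1, by omega⟩
    have hk' : 2 * m - (j + 1) = k := by omega
    have hs' : s (2 * m + j + 1) = s (k + 1) := by
      rw [← hs (k + 1) (by omega) (by omega)]
      congr 1
      omega
    rw [hk'] at *
    rw [hk] at h1 h2
    have e1 := chainState_succ_fst s lam k
    have e2 := chainState_succ_snd s lam k
    have e3 := chainState_succ_fst s lam (2 * m + j)
    have e4 := chainState_succ_snd s lam (2 * m + j + 1)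
    have h3 : (chainState s lam (2 * m + (j + 1))).1 = (chainState s lam k).1 := by
      rw [← add_assoc, e3, h2, h1, hs']
      linear_combination e1
    refine ⟨h3, ?_⟩
    rw [← add_assoc, e4, h2, add_assoc, h3]
    linear_combination -e2

/-- If the flux behind the last resonator of a mirror-symmetric chain vanishes, the solution is a
multiple of its mirror image. -/
lemma chainState_symm_of_end {N : ℕ} (hs : ∀ i, 1 ≤ i → i ≤ N → s (N + 1 - i) = s i)
    (h : (chainState s lam (N + 1)).2 = 0) :
    ∀ j ≤ N, (chainState s lam (N - j)).1 = (chainState s lam N).1 * (chainState s lam j).1 ∧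
      (chainState s lam (N - j + 1)).2
        = -((chainState s lam N).1 * (chainState s lam j).2) := by
  intro j
  induction j with
  | zero => intro _; simp [h]
  | succ j ih =>
    intro hj
    obtain ⟨h1, h2⟩ := ih (by omega)
    obtain ⟨k, hk⟩ : ∃ k, N - j = k + 1 := ⟨N - j - 1, by omega⟩
    have hk' : N - (j + 1) = k := by omega
    have hs' : s (j + 1) = s (k + 1) := by
      rw [← hs (j + 1) (by omega) (by omega)]
      congr 1
      omega
    rw [hk'] at *
    rw [hk] at h1 h2
    have e1 := chainState_succ_fst s lam k
    have e2 := chainState_succ_snd s lam (k + 1)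
    have e3 := chainState_succ_fst s lam j
    have e4 := chainState_succ_snd s lam j
    have h3 : (chainState s lam (k + 1)).2
        = -((chainState s lam N).1 * (chainState s lam (j + 1)).2) := by
      rw [e4]
      linear_combination h2 - e2 + lam * h1
    refine ⟨?_, h3⟩
    rw [e3, hs']
    linear_combination h1 - e1 - s (k + 1) * h3

/-- A mirror-symmetric chain whose middle entry does not vanish has the eigenvalue `lam` if and
only if the fluxes on the two sides of the middle resonator are opposite. -/
lemma chainState_end_eq_zero_iff [IsDomain R] {m : ℕ}
    (hs : ∀ i, 1 ≤ i → i ≤ 4 * m → s (4 * m + 1 - i) = s i)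
    (h0 : (chainState s lam (2 * m)).1 ≠ 0) :
    (chainState s lam (4 * m + 1)).2 = 0
      ↔ 2 * (chainState s lam (2 * m)).2 = lam * (chainState s lam (2 * m)).1 := by
  constructor
  · intro h
    obtain ⟨h1, h2⟩ := chainState_symm_of_end s lam hs h (2 * m) (by omega)
    rw [show 4 * m - 2 * m = 2 * m by omega] at h1 h2
    have hr : (chainState s lam (4 * m)).1 = 1 := by
      apply mul_right_cancel₀ h0
      rw [← h1, one_mul]
    rw [hr, chainState_succ_snd] at h2
    linear_combination h2
  · intro h
    have := (chainState_symm_of_center s lam hs h (2 * m) le_rfl).2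
    rw [show 2 * m + 2 * m + 1 = 4 * m + 1 by omega] at this
    simpa using this

end Ring

section Derivative

variable {𝕜 : Type*} [NontriviallyNormedField 𝕜] (s : ℕ → 𝕜)

/-- The discrete Green identity between the solution `a` and its derivative with respect to the
spectral parameter: the Wronskian of the two is `-∑ a_j ^ 2`. -/
lemma exists_hasDerivAt_chainState (lam : 𝕜) (n : ℕ) : ∃ a' y' : 𝕜,
    HasDerivAt (fun l => (chainState s l n).1) a' lam ∧
    HasDerivAt (fun l => (chainState s l n).2) y' lam ∧
    y' * (chainState s lam n).1 - (chainState s lam n).2 * a'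
      = -∑ j ∈ Finset.range n, (chainState s lam j).1 ^ 2 := by
  induction n with
  | zero => exact ⟨0, 0, hasDerivAt_const _ _, hasDerivAt_const _ _, by simp⟩
  | succ n ih =>
    obtain ⟨a', y', ha, hy, hW⟩ := ih
    have hy' : HasDerivAt (fun l => (chainState s l (n + 1)).2)
        (y' - (1 * (chainState s lam n).1 + lam * a')) lam :=
      hy.sub ((hasDerivAt_id lam).mul ha)
    refine ⟨_, _, ha.add (hy'.const_mul (s (n + 1))), hy', ?_⟩
    rw [Finset.sum_range_succ, chainState_succ_fst, chainState_succ_snd]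
    linear_combination hW

end Derivative

/-! ### Eigenvectors of the capacitance matrix -/

/-- The rows of the capacitance matrix in terms of the fluxes through the spacings. The values of
`b` beyond the two ends of the chain, and the truncated index `i - 1` at `i = 0`, come with the
factor `invSpacing = 0`. -/
lemma capacitanceMatrix_mulVec_apply (s : ℕ → ℝ) (N : ℕ) (b : ℕ → ℝ) (i : Fin N) :
    (capacitanceMatrix s N).mulVec (fun j : Fin N => b j) i
      = invSpacing s N i * (b i - b (i - 1)) - invSpacing s N (i + 1) * (b (i + 1) - b i) := by
  obtain ⟨i, hi⟩ := i
  have key : ∀ j : ℕ, ((if i = j then invSpacing s N i + invSpacing s N (i + 1)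
      else if j = i + 1 then -invSpacing s N j
      else if i = j + 1 then -invSpacing s N i else 0) * b j)
      = (if i = j then (invSpacing s N i + invSpacing s N (i + 1)) * b j else 0)
        + (if i + 1 = j then -invSpacing s N j * b j else 0)
        + (if j + 1 = i then -invSpacing s N i * b j else 0) := by
    intro j
    split_ifs <;> first | omega | ring
  have h0 : invSpacing s N 0 = 0 := by simp [invSpacing]
  have hN : invSpacing s N N = 0 := by simp [invSpacing]
  have e3 : (∑ j ∈ Finset.range N, if j + 1 = i then -invSpacing s N i * b j else 0)
      = -invSpacing s N i * b (i - 1) := by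
    rcases Nat.eq_zero_or_pos i with rfl | hpos
    · simp [h0]
    · rw [Finset.sum_eq_single (i - 1)]
      · rw [if_pos (by omega)]
      · intro j _ hj
        rw [if_neg (by omega)]
      · intro h
        exact absurd (Finset.mem_range.2 (by omega)) h
  simp only [Matrix.mulVec, dotProduct, capacitanceMatrix]
  rw [Fin.sum_univ_eq_sum_range (fun j => (if i = j then invSpacing s N i + invSpacing s N (i + 1)
      else if j = i + 1 then -invSpacing s N j
      else if i = j + 1 then -invSpacing s N i else 0) * b j) N]
  simp only [key, Finset.sum_add_distrib, e3, Finset.sum_ite_eq, Finset.mem_range, hi, if_true]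
  by_cases h1 : i + 1 < N
  · rw [if_pos h1]; ring
  · have : i + 1 = N := by omega
    rw [if_neg h1, this, hN]; ring

/-- Eigenvectors of the capacitance matrix are the multiples of the shot solution, provided that
its flux behind the last resonator vanishes. -/
lemma capacitanceMatrix_mulVec_eq_smul_iff {s : ℕ → ℝ} {N : ℕ} (hN : 0 < N)
    (hs : ∀ i, 0 < s i) (mu : ℝ) (a : Fin N → ℝ) :
    (capacitanceMatrix s N).mulVec a = mu • a ↔
      (∀ i : Fin N, a i = a ⟨0, hN⟩ * (chainState s mu i).1) ∧
        a ⟨0, hN⟩ * (chainState s mu N).2 = 0 := by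
  obtain ⟨b, rfl⟩ : ∃ b : ℕ → ℝ, a = fun i : Fin N => b i :=
    ⟨fun n => if h : n < N then a ⟨n, h⟩ else 0, by ext i; simp⟩
  have hrow : (capacitanceMatrix s N).mulVec (fun i : Fin N => b i)
      = mu • (fun i : Fin N => b i) ↔ ∀ i < N, invSpacing s N i * (b i - b (i - 1))
        - invSpacing s N (i + 1) * (b (i + 1) - b i) = mu * b i := by
    rw [funext_iff]
    constructor
    · intro h i hi
      have := h ⟨i, hi⟩
      rwa [capacitanceMatrix_mulVec_apply] at this
    · intro h i
      rw [capacitanceMatrix_mulVec_apply]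
      exact h i i.2
  rw [hrow]
  have h0 : invSpacing s N 0 = 0 := by simp [invSpacing]
  have hNN : invSpacing s N N = 0 := by simp [invSpacing]
  have hinv : ∀ n, n + 1 < N → invSpacing s N (n + 1) = (s (n + 1))⁻¹ := by
    intro n hn
    simp [invSpacing, hn]
  constructor
  · intro h
    have key : ∀ n < N, b n = b 0 * (chainState s mu n).1 ∧
        invSpacing s N n * (b n - b (n - 1)) = b 0 * (chainState s mu n).2 := by
      intro n
      induction n with
      | zero => intro _; simp
      | succ n ih =>
        intro hn
        obtain ⟨i1, i2⟩ := ih (by omega)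
        have hr := h n (by omega)
        have hflux : invSpacing s N (n + 1) * (b (n + 1) - b n)
            = b 0 * (chainState s mu (n + 1)).2 := by
          rw [chainState_succ_snd]
          linear_combination i2 - hr - mu * i1
        refine ⟨?_, by simpa using hflux⟩
        rw [hinv n hn] at hflux
        have := (hs (n + 1)).ne'
        rw [chainState_succ_fst]
        field_simp at hflux
        linear_combination hflux + i1
    refine ⟨fun i => (key i i.2).1, ?_⟩
    obtain ⟨k, rfl⟩ : ∃ k, N = k + 1 := ⟨N - 1, by omega⟩
    obtain ⟨i1, i2⟩ := key k (by omega)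
    have hr := h k (by omega)
    rw [hNN] at hr
    rw [chainState_succ_snd]
    linear_combination -i2 + hr + mu * i1
  · rintro ⟨h1, h2⟩ i hi
    have hb : ∀ n < N, b n = b 0 * (chainState s mu n).1 := fun n hn => h1 ⟨n, hn⟩
    have hflux : ∀ n < N, invSpacing s N n * (b n - b (n - 1)) = b 0 * (chainState s mu n).2 := by
      intro n hn
      rcases n with _ | n
      · simp [h0]
      · rw [hinv n hn, Nat.add_sub_cancel, hb _ hn, hb n (by omega), chainState_succ_fst]
        have := (hs (n + 1)).ne'
        field_simp
        ring
    have hflux' : invSpacing s N (i + 1) * (b (i + 1) - b i)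
        = b 0 * (chainState s mu (i + 1)).2 := by
      by_cases h : i + 1 < N
      · simpa using hflux (i + 1) h
      · have : i + 1 = N := by omega
        rw [this, hNN, zero_mul]
        exact h2.symm
    rw [hflux i hi, hflux', hb i hi, chainState_succ_snd]
    ring

/-! ### The transfer matrix of a dimer in the band gap -/

/-- Minus half the trace of the transfer matrix of a dimer. -/
noncomputable def cellTrace (s₁ s₂ l : ℝ) : ℝ := l * (s₁ + s₂ - s₁ * s₂ * l / 2) - 1

/-- Minus the upper right entry of the transfer matrix of a dimer between the midpoints of two
successive spacings `s₂`. -/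
noncomputable def cellUpper (s₁ s₂ l : ℝ) : ℝ := (s₁ + s₂ - s₁ * s₂ * l / 2) * (s₂ * l - 2) / 2

/-- Minus the lower left entry of the transfer matrix of a dimer between the midpoints of two
successive spacings `s₂`. -/
noncomputable def cellLower (s₁ l : ℝ) : ℝ := l * (2 - s₁ * l)

/-- Value and flux at the midpoints of the spacings `s₂` of the left half of the chain, up to the
sign `(-1) ^ j`. The cell from midpoint to midpoint is mirror symmetric, so that both diagonal
entries of its transfer matrix are the half trace; in the band gap, all entries are negative. -/
noncomputable def cellState (s₁ s₂ l : ℝ) : ℕ → ℝ × ℝ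
  | 0 => (1, 0)
  | j + 1 => (cellTrace s₁ s₂ l * (cellState s₁ s₂ l j).1
        + cellUpper s₁ s₂ l * (cellState s₁ s₂ l j).2,
      cellLower s₁ l * (cellState s₁ s₂ l j).1 + cellTrace s₁ s₂ l * (cellState s₁ s₂ l j).2)

lemma defectSpacing_pos {s₁ s₂ : ℝ} (h₁ : 0 < s₁) (h₂ : 0 < s₂) (m i : ℕ) :
    0 < defectSpacing m s₁ s₂ i := by
  unfold defectSpacing
  split_ifs <;> assumption

lemma defectSpacing_le {s₁ s₂ : ℝ} (h : s₁ ≤ s₂) (m i : ℕ) : defectSpacing m s₁ s₂ i ≤ s₂ := by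
  unfold defectSpacing
  split_ifs <;> first | exact h | exact le_rfl

lemma defectSpacing_symm (s₁ s₂ : ℝ) (m i : ℕ) (_ : 1 ≤ i) (_ : i ≤ 4 * m) :
    defectSpacing m s₁ s₂ (4 * m + 1 - i) = defectSpacing m s₁ s₂ i := by
  unfold defectSpacing
  simp only [Nat.odd_iff]
  split_ifs <;> first | rfl | omega

lemma defectSpacing_odd (s₁ s₂ : ℝ) {m j : ℕ} (h : j < m) :
    defectSpacing m s₁ s₂ (2 * j + 1) = s₁ := by
  unfold defectSpacing
  rw [if_pos (by omega), if_pos (by simp)]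

lemma defectSpacing_even (s₁ s₂ : ℝ) {m j : ℕ} (h : j < m) :
    defectSpacing m s₁ s₂ (2 * j + 1 + 1) = s₂ := by
  unfold defectSpacing
  rw [if_pos (by omega), if_neg (by simp [Nat.odd_iff]; omega)]

/-- The state at a resonator of odd number, half a spacing `s₂` behind the midpoint state. -/
lemma chainState_eq_cellState (s₁ s₂ l : ℝ) (m : ℕ) : ∀ j ≤ m,
    chainState (defectSpacing m s₁ s₂) l (2 * j)
      = ((-1) ^ j * ((cellState s₁ s₂ l j).1 + s₂ / 2 * (cellState s₁ s₂ l j).2),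
        (-1) ^ j * (cellState s₁ s₂ l j).2) := by
  intro j
  induction j with
  | zero => intro _; simp [cellState]
  | succ j ih =>
    intro hj
    have h := ih (by omega)
    rw [show 2 * (j + 1) = 2 * j + 1 + 1 by ring]
    simp only [chainState, h, defectSpacing_odd s₁ s₂ (show j < m by omega),
      defectSpacing_even s₁ s₂ (show j < m by omega), cellState, cellTrace, cellUpper, cellLower]
    ext <;> simp only [pow_succ] <;> ring

/-- The entry at a resonator of even number, half a spacing `s₂` before the midpoint state. -/
lemma chainState_odd_fst (s₁ s₂ l : ℝ) {m j : ℕ} (hj : j < m) :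
    (chainState (defectSpacing m s₁ s₂) l (2 * j + 1)).1
      = (-1) ^ (j + 1) * ((cellState s₁ s₂ l (j + 1)).1
        - s₂ / 2 * (cellState s₁ s₂ l (j + 1)).2) := by
  have h := chainState_eq_cellState s₁ s₂ l m (j + 1) hj
  rw [show 2 * (j + 1) = 2 * j + 1 + 1 by ring] at h
  have h1 := congrArg Prod.fst h
  have h2 := congrArg Prod.snd h
  rw [chainState_succ_fst, defectSpacing_even s₁ s₂ hj, h2] at h1
  simp only at h1
  linear_combination h1

lemma mul_lt_of_mem_bandGap {s₁ s₂ l : ℝ} (hs₁ : 0 < s₁) (hs₂ : s₁ < s₂)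
    (hl : l ∈ bandGap s₁ s₂) : 0 < l ∧ s₁ * l < 2 ∧ 2 < s₂ * l := by
  have h2 : 0 < s₂ := hs₁.trans hs₂
  obtain ⟨ha, hb⟩ := hl
  refine ⟨lt_trans (by positivity) ha, ?_, ?_⟩
  · rw [lt_div_iff₀ hs₁] at hb; linarith
  · rw [div_lt_iff₀ h2] at ha; linarith

section Gap

variable {s₁ s₂ l : ℝ}

lemma cellTrace_sub_one (s₁ s₂ l : ℝ) :
    cellTrace s₁ s₂ l - 1 = (2 - s₁ * l) * (s₂ * l - 2) / 2 := by
  unfold cellTrace; ring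

lemma one_lt_cellTrace (hs₁ : 0 < s₁) (hs₂ : s₁ < s₂) (hl : l ∈ bandGap s₁ s₂) :
    1 < cellTrace s₁ s₂ l := by
  obtain ⟨-, h1, h2⟩ := mul_lt_of_mem_bandGap hs₁ hs₂ hl
  have := cellTrace_sub_one s₁ s₂ l
  have : 0 < (2 - s₁ * l) * (s₂ * l - 2) := mul_pos (by linarith) (by linarith)
  linarith

lemma cellUpper_pos (hs₁ : 0 < s₁) (hs₂ : s₁ < s₂) (hl : l ∈ bandGap s₁ s₂) :
    0 < cellUpper s₁ s₂ l := by
  obtain ⟨-, h1, h2⟩ := mul_lt_of_mem_bandGap hs₁ hs₂ hl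
  have h3 : 0 < s₂ * (2 - s₁ * l) := mul_pos (hs₁.trans hs₂) (by linarith)
  unfold cellUpper
  have : 0 < s₁ + s₂ - s₁ * s₂ * l / 2 := by nlinarith
  have : 0 < s₂ * l - 2 := by linarith
  positivity

lemma cellLower_pos (hs₁ : 0 < s₁) (hs₂ : s₁ < s₂) (hl : l ∈ bandGap s₁ s₂) :
    0 < cellLower s₁ l := by
  obtain ⟨h0, h1, -⟩ := mul_lt_of_mem_bandGap hs₁ hs₂ hl
  exact mul_pos h0 (by linarith)

lemma cellState_nonneg (hs₁ : 0 < s₁) (hs₂ : s₁ < s₂) (hl : l ∈ bandGap s₁ s₂) (j : ℕ) :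
    0 < (cellState s₁ s₂ l j).1 ∧ 0 ≤ (cellState s₁ s₂ l j).2 := by
  have ht := one_lt_cellTrace hs₁ hs₂ hl
  have hb := cellUpper_pos hs₁ hs₂ hl
  have hg := cellLower_pos hs₁ hs₂ hl
  induction j with
  | zero => simp [cellState]
  | succ j ih =>
    obtain ⟨h1, h2⟩ := ih
    simp only [cellState]
    constructor <;> positivity

/-- The transfer matrix of a dimer has determinant `1` and equal diagonal entries, and therefore
preserves a quadratic form. -/
lemma cellState_invariant (s₁ s₂ l : ℝ) (j : ℕ) :
    cellLower s₁ l * (cellState s₁ s₂ l j).1 ^ 2 - cellUpper s₁ s₂ l * (cellState s₁ s₂ l j).2 ^ 2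
      = cellLower s₁ l := by
  induction j with
  | zero => simp [cellState]
  | succ j ih =>
    have hdet : cellTrace s₁ s₂ l ^ 2 - cellUpper s₁ s₂ l * cellLower s₁ l = 1 := by
      unfold cellTrace cellUpper cellLower; ring
    simp only [cellState]
    linear_combination ih + (cellLower s₁ l * (cellState s₁ s₂ l j).1 ^ 2
      - cellUpper s₁ s₂ l * (cellState s₁ s₂ l j).2 ^ 2) * hdet

lemma pow_mul_cellState_le (hs₁ : 0 < s₁) (hs₂ : s₁ < s₂) (hl : l ∈ bandGap s₁ s₂) {t : ℝ}
    (ht0 : 0 ≤ t) (ht : t ≤ cellTrace s₁ s₂ l) (j k : ℕ) :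
    t ^ k * (cellState s₁ s₂ l j).1 ≤ (cellState s₁ s₂ l (j + k)).1 ∧
      t ^ k * (cellState s₁ s₂ l j).2 ≤ (cellState s₁ s₂ l (j + k)).2 := by
  have hb := cellUpper_pos hs₁ hs₂ hl
  have hg := cellLower_pos hs₁ hs₂ hl
  induction k with
  | zero => simp
  | succ k ih =>
    obtain ⟨h1, h2⟩ := cellState_nonneg hs₁ hs₂ hl (j + k)
    obtain ⟨i1, i2⟩ := ih
    rw [← add_assoc]
    simp only [cellState]
    have e1 : t * (cellState s₁ s₂ l (j + k)).1
        ≤ cellTrace s₁ s₂ l * (cellState s₁ s₂ l (j + k)).1 :=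
      mul_le_mul_of_nonneg_right ht h1.le
    have e2 : t * (cellState s₁ s₂ l (j + k)).2
        ≤ cellTrace s₁ s₂ l * (cellState s₁ s₂ l (j + k)).2 :=
      mul_le_mul_of_nonneg_right ht h2
    have e3 := mul_le_mul_of_nonneg_left i1 ht0
    have e4 := mul_le_mul_of_nonneg_left i2 ht0
    have e5 := mul_nonneg hb.le h2
    have e6 := mul_nonneg hg.le h1.le
    constructor <;> rw [pow_succ'] <;> linarith

lemma chainState_center_ne_zero (hs₁ : 0 < s₁) (hs₂ : s₁ < s₂) (hl : l ∈ bandGap s₁ s₂) (m : ℕ) :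
    (chainState (defectSpacing m s₁ s₂) l (2 * m)).1 ≠ 0 := by
  obtain ⟨h1, h2⟩ := cellState_nonneg hs₁ hs₂ hl m
  rw [chainState_eq_cellState s₁ s₂ l m m le_rfl]
  have : 0 < s₂ := hs₁.trans hs₂
  refine mul_ne_zero (by simp) (ne_of_gt ?_)
  positivity

/-- A solution in the band gap grows by a factor of at least `t` per dimer, from the left end of
the chain up to the interface. -/
lemma abs_chainState_le (hs₁ : 0 < s₁) (hs₂ : s₁ < s₂) (hl : l ∈ bandGap s₁ s₂) {t : ℝ}
    (ht0 : 1 ≤ t) (ht : t ≤ cellTrace s₁ s₂ l) {m j n : ℕ} (hj : j ≤ m)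
    (hn : n = 2 * j ∨ n + 1 = 2 * j) :
    t ^ (m - j) * |(chainState (defectSpacing m s₁ s₂) l n).1|
      ≤ |(chainState (defectSpacing m s₁ s₂) l (2 * m)).1| := by
  have h2pos : 0 < s₂ := hs₁.trans hs₂
  obtain ⟨h1, h2⟩ := cellState_nonneg hs₁ hs₂ hl j
  obtain ⟨c1, c2⟩ := cellState_nonneg hs₁ hs₂ hl m
  have hle : |(chainState (defectSpacing m s₁ s₂) l n).1|
      ≤ (cellState s₁ s₂ l j).1 + s₂ / 2 * (cellState s₁ s₂ l j).2 := by
    have hQ : 0 ≤ s₂ / 2 * (cellState s₁ s₂ l j).2 := by positivity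
    rcases hn with rfl | hn
    · rw [chainState_eq_cellState s₁ s₂ l m j hj, abs_mul, abs_pow, abs_neg, abs_one, one_pow,
        one_mul, abs_of_nonneg (by positivity)]
    · obtain ⟨i, rfl⟩ : ∃ i, j = i + 1 := ⟨j - 1, by omega⟩
      obtain rfl : n = 2 * i + 1 := by omega
      rw [chainState_odd_fst s₁ s₂ l hj, abs_mul, abs_pow, abs_neg, abs_one, one_pow, one_mul,
        abs_le]
      constructor <;> linarith
  have hc : |(chainState (defectSpacing m s₁ s₂) l (2 * m)).1|
      = (cellState s₁ s₂ l m).1 + s₂ / 2 * (cellState s₁ s₂ l m).2 := by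
    rw [chainState_eq_cellState s₁ s₂ l m m le_rfl, abs_mul, abs_pow, abs_neg, abs_one, one_pow,
        one_mul, abs_of_nonneg (by positivity)]
  obtain ⟨g1, g2⟩ := pow_mul_cellState_le hs₁ hs₂ hl (by linarith) ht j (m - j)
  rw [show j + (m - j) = m by omega] at g1 g2
  rw [hc]
  calc _ ≤ t ^ (m - j) * ((cellState s₁ s₂ l j).1 + s₂ / 2 * (cellState s₁ s₂ l j).2) := by
        gcongr
    _ = t ^ (m - j) * (cellState s₁ s₂ l j).1
        + s₂ / 2 * (t ^ (m - j) * (cellState s₁ s₂ l j).2) := by ring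
    _ ≤ _ := by gcongr

end Gap

/-! ### The eigenvalue in the band gap -/

/-- The ratio of flux and value at the interface is strictly decreasing in the spectral parameter
throughout the band gap, because the value has no zero there. -/
lemma center_unique {s₁ s₂ : ℝ} (hs₁ : 0 < s₁) (hs₂ : s₁ < s₂) (m : ℕ) {l l' : ℝ}
    (hl : l ∈ bandGap s₁ s₂) (hl' : l' ∈ bandGap s₁ s₂)
    (h : 2 * (chainState (defectSpacing m s₁ s₂) l (2 * m)).2
      = l * (chainState (defectSpacing m s₁ s₂) l (2 * m)).1)
    (h' : 2 * (chainState (defectSpacing m s₁ s₂) l' (2 * m)).2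
      = l' * (chainState (defectSpacing m s₁ s₂) l' (2 * m)).1) : l = l' := by
  set s := defectSpacing m s₁ s₂ with hs
  let g : ℝ → ℝ := fun l => 2 * ((chainState s l (2 * m)).2 / (chainState s l (2 * m)).1) - l
  have hder : ∀ x ∈ bandGap s₁ s₂, ∃ d < 0, HasDerivAt g d x := by
    intro x hx
    have hne := chainState_center_ne_zero hs₁ hs₂ hx m
    obtain ⟨a', y', ha, hy, hW⟩ := exists_hasDerivAt_chainState s x (2 * m)
    refine ⟨_, ?_, ((hy.div ha hne).const_mul 2).sub (hasDerivAt_id x)⟩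
    rw [hW]
    have : 0 ≤ ∑ j ∈ Finset.range (2 * m), (chainState s x j).1 ^ 2 :=
      Finset.sum_nonneg fun _ _ => sq_nonneg _
    have := div_nonneg this (sq_nonneg (chainState s x (2 * m)).1)
    rw [neg_div]
    linarith
  have hanti : StrictAntiOn g (bandGap s₁ s₂) := by
    apply strictAntiOn_of_deriv_neg (convex_Ioo _ _)
    · intro x hx
      obtain ⟨d, -, hd⟩ := hder x hx
      exact hd.continuousAt.continuousWithinAt
    · intro x hx
      obtain ⟨d, hd0, hd⟩ := hder x (interior_subset hx)
      rw [hd.deriv]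
      exact hd0
  refine hanti.injOn hl hl' ?_
  have e := chainState_center_ne_zero hs₁ hs₂ hl m
  have e' := chainState_center_ne_zero hs₁ hs₂ hl' m
  rw [← hs] at e e'
  have e1 : g l = 0 := by
    simp only [g]
    field_simp
    linarith
  have e2 : g l' = 0 := by
    simp only [g]
    field_simp
    linarith
  rw [e1, e2]

/-- The limit of the eigenvalues in the band gap for long chains. -/
noncomputable def interfaceEigenvalue (s₁ s₂ : ℝ) : ℝ :=
  1 / 2 * (-√(9 / s₁ ^ 2 - 14 / (s₁ * s₂) + 9 / s₂ ^ 2) + 3 / s₁ + 3 / s₂)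

/-- The distance between the two roots of the quadratic equation whose smaller root is
`interfaceEigenvalue`. -/
noncomputable def rootGap (s₁ s₂ : ℝ) : ℝ := √(9 / s₁ ^ 2 - 14 / (s₁ * s₂) + 9 / s₂ ^ 2)

section Limit

variable {s₁ s₂ : ℝ}

lemma rootGap_sq_and_bounds (hs₁ : 0 < s₁) (hs₂ : s₁ < s₂) :
    rootGap s₁ s₂ ^ 2 = 9 / s₁ ^ 2 - 14 / (s₁ * s₂) + 9 / s₂ ^ 2 ∧ 0 < rootGap s₁ s₂ ∧
    2 / s₂ < interfaceEigenvalue s₁ s₂ ∧ interfaceEigenvalue s₁ s₂ < 2 / s₁ ∧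
    interfaceEigenvalue s₁ s₂ < 4 / s₂ := by
  have h2 : 0 < s₂ := hs₁.trans hs₂
  obtain ⟨a, ha⟩ : ∃ a, a = 1 / s₁ := ⟨_, rfl⟩
  obtain ⟨b, hb⟩ : ∃ b, b = 1 / s₂ := ⟨_, rfl⟩
  have hb0 : 0 < b := by rw [hb]; positivity
  have hab : b < a := by rw [ha, hb]; exact one_div_lt_one_div_of_lt hs₁ hs₂
  have hD : 9 / s₁ ^ 2 - 14 / (s₁ * s₂) + 9 / s₂ ^ 2 = 9 * a ^ 2 - 14 * (a * b) + 9 * b ^ 2 := by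
    rw [ha, hb]; field_simp
  have hD0 : 0 < 9 * a ^ 2 - 14 * (a * b) + 9 * b ^ 2 := by nlinarith [sq_nonneg (a - b)]
  unfold interfaceEigenvalue rootGap
  rw [hD]
  have e1 : 3 / s₁ = 3 * a := by rw [ha]; ring
  have e2 : 3 / s₂ = 3 * b := by rw [hb]; ring
  have e3 : 2 / s₂ = 2 * b := by rw [hb]; ring
  have e4 : 2 / s₁ = 2 * a := by rw [ha]; ring
  have e5 : 4 / s₂ = 4 * b := by rw [hb]; ring
  rw [e1, e2, e3, e4, e5]
  refine ⟨Real.sq_sqrt hD0.le, Real.sqrt_pos.2 hD0, ?_, ?_, ?_⟩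
  · have : √(9 * a ^ 2 - 14 * (a * b) + 9 * b ^ 2) < 3 * a - b := by
      rw [Real.sqrt_lt' (by linarith)]
      nlinarith
    linarith
  · have : 3 * b - a < √(9 * a ^ 2 - 14 * (a * b) + 9 * b ^ 2) := by
      apply Real.lt_sqrt_of_sq_lt
      nlinarith
    linarith
  · have : 3 * a - 5 * b < √(9 * a ^ 2 - 14 * (a * b) + 9 * b ^ 2) := by
      apply Real.lt_sqrt_of_sq_lt
      nlinarith
    linarith

/-- Factorisation of the quadratic polynomial in `matching_identity`. -/
lemma interface_factorisation (hs₁ : 0 < s₁) (hs₂ : s₁ < s₂) (l : ℝ) :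
    s₁ * s₂ * l ^ 2 - 3 * (s₁ + s₂) * l + 8
      = s₁ * s₂ * ((interfaceEigenvalue s₁ s₂ - l)
        * (interfaceEigenvalue s₁ s₂ + rootGap s₁ s₂ - l)) := by
  have h2 : 0 < s₂ := hs₁.trans hs₂
  obtain ⟨hsq, -⟩ := rootGap_sq_and_bounds hs₁ hs₂
  have e : interfaceEigenvalue s₁ s₂ = 1 / 2 * (-rootGap s₁ s₂ + 3 / s₁ + 3 / s₂) := rfl
  rw [e]
  field_simp at hsq ⊢
  linear_combination hsq

/-- The squared form of the matching condition at the interface, from which the flux is eliminated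
by means of `cellState_invariant`: the difference of the squares of its two sides has the sign of a
quadratic polynomial in `l`, up to a term that is negligible when the value is large. -/
lemma matching_identity (s₁ s₂ l : ℝ) (m : ℕ) :
    cellUpper s₁ s₂ l * (((4 - s₂ * l) * (cellState s₁ s₂ l m).2) ^ 2
        - (2 * l * (cellState s₁ s₂ l m).1) ^ 2)
      = l * (4 * (s₁ * s₂ * l ^ 2 - 3 * (s₁ + s₂) * l + 8) * (cellState s₁ s₂ l m).1 ^ 2
        - (4 - s₂ * l) ^ 2 * (2 - s₁ * l)) := by
  have h := cellState_invariant s₁ s₂ l m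
  have hb : cellUpper s₁ s₂ l = (s₁ + s₂ - s₁ * s₂ * l / 2) * (s₂ * l - 2) / 2 := rfl
  have hg : cellLower s₁ l = l * (2 - s₁ * l) := rfl
  rw [hg] at h
  linear_combination -(4 - s₂ * l) ^ 2 * h
    - (2 * l * (cellState s₁ s₂ l m).1) ^ 2 * hb

end Limit

/-- The matching condition `2 y = l a` in the sign-free variables of `cellState`. -/
lemma matching_eq (s₁ s₂ l : ℝ) (m : ℕ) :
    (-1) ^ m * (2 * (2 * (chainState (defectSpacing m s₁ s₂) l (2 * m)).2
      - l * (chainState (defectSpacing m s₁ s₂) l (2 * m)).1))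
      = (4 - s₂ * l) * (cellState s₁ s₂ l m).2 - 2 * l * (cellState s₁ s₂ l m).1 := by
  rw [chainState_eq_cellState s₁ s₂ l m m le_rfl]
  have h : ((-1 : ℝ) ^ m) * (-1) ^ m = 1 := by rw [← mul_pow]; simp
  linear_combination ((4 - s₂ * l) * (cellState s₁ s₂ l m).2
    - 2 * l * (cellState s₁ s₂ l m).1) * h

/-- For long chains, the matching condition at the interface has a root in the gap, exponentially
close to the limiting eigenvalue. The quadratic polynomial that vanishes at the limiting
eigenvalue is positive to its left, and the corrections for finite `m` are dominated by the
exponentially growing `cellState`. -/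
lemma exists_matching_root {s₁ s₂ : ℝ} (hs₁ : 0 < s₁) (hs₂ : s₁ < s₂) :
    ∃ (M : ℕ) (t A : ℝ), 1 < t ∧ 0 < A ∧ ∀ m ≥ M, ∃ l ∈ bandGap s₁ s₂,
      2 * (chainState (defectSpacing m s₁ s₂) l (2 * m)).2
        = l * (chainState (defectSpacing m s₁ s₂) l (2 * m)).1 ∧
      t ≤ cellTrace s₁ s₂ l ∧ |interfaceEigenvalue s₁ s₂ - l| < A * (t ^ m)⁻¹ := by
  have h2pos : 0 < s₂ := hs₁.trans hs₂
  obtain ⟨-, hD, hL1, hL2, hL3⟩ := rootGap_sq_and_bounds hs₁ hs₂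
  set L := interfaceEigenvalue s₁ s₂ with hL
  set D := rootGap s₁ s₂ with hDdef
  -- any point between the lower edge of the gap and the limiting eigenvalue serves as left end
  obtain ⟨l₀, hl₀, hl₀L⟩ := exists_between hL1
  have hmem : ∀ l, l₀ ≤ l → l ≤ L → l ∈ bandGap s₁ s₂ := fun l h h' =>
    ⟨hl₀.trans_le h, h'.trans_lt hL2⟩
  obtain ⟨-, hLa, hLb⟩ := mul_lt_of_mem_bandGap hs₁ hs₂ (hmem L hl₀L.le le_rfl)
  obtain ⟨-, hla, hlb⟩ := mul_lt_of_mem_bandGap hs₁ hs₂ (hmem l₀ le_rfl hl₀L.le)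
  have hL4 : s₂ * L < 4 := by rw [lt_div_iff₀ h2pos] at hL3; linarith
  -- a lower bound for `cellTrace` on `[l₀, L]`
  set t : ℝ := 1 + (2 - s₁ * L) * (s₂ * l₀ - 2) / 2 with ht
  have ht1 : 1 < t := by
    have : 0 < (2 - s₁ * L) * (s₂ * l₀ - 2) := mul_pos (by linarith) (by linarith)
    linarith
  have htr : ∀ l, l₀ ≤ l → l ≤ L → t ≤ cellTrace s₁ s₂ l := by
    intro l h h'
    have e := cellTrace_sub_one s₁ s₂ l
    have e1 : s₁ * l ≤ s₁ * L := mul_le_mul_of_nonneg_left h' hs₁.le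
    have e2 : s₂ * l₀ ≤ s₂ * l := mul_le_mul_of_nonneg_left h h2pos.le
    have : (2 - s₁ * L) * (s₂ * l₀ - 2) ≤ (2 - s₁ * l) * (s₂ * l - 2) :=
      mul_le_mul (by linarith) (by linarith) (by linarith) (by linarith)
    linarith
  have hgrow : ∀ l, l₀ ≤ l → l ≤ L → ∀ m, t ^ m ≤ (cellState s₁ s₂ l m).1 ^ 2 := by
    intro l h h' m
    have e := (pow_mul_cellState_le hs₁ hs₂ (hmem l h h') (by linarith) (htr l h h') 0 m).1
    simp only [cellState, mul_one, zero_add] at e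
    have e1 : 1 ≤ t ^ m := one_le_pow₀ ht1.le
    nlinarith
  have hrhs : ∀ l, l₀ ≤ l → l ≤ L → 0 < (4 - s₂ * l) ^ 2 * (2 - s₁ * l) ∧
      (4 - s₂ * l) ^ 2 * (2 - s₁ * l) < 8 := by
    intro l h h'
    obtain ⟨h0, h1, h2⟩ := mul_lt_of_mem_bandGap hs₁ hs₂ (hmem l h h')
    have e2 : s₂ * l ≤ s₂ * L := mul_le_mul_of_nonneg_left h' h2pos.le
    have e3 : 0 < s₁ * l := mul_pos hs₁ h0
    have e4 : 0 < 4 - s₂ * l := by linarith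
    have e5 : 0 < 2 - s₁ * l := by linarith
    refine ⟨by positivity, ?_⟩
    have e6 : (4 - s₂ * l) ^ 2 < 4 := by nlinarith
    nlinarith
  have hfac := interface_factorisation hs₁ hs₂
  rw [← hL, ← hDdef] at hfac
  set q : ℝ → ℝ := fun l => s₁ * s₂ * l ^ 2 - 3 * (s₁ + s₂) * l + 8 with hq
  have hq0 : 0 < q l₀ := by
    simp only [hq]
    rw [hfac]
    have : 0 < L - l₀ := by linarith
    have : 0 < L + D - l₀ := by linarith
    positivity
  obtain ⟨M, hM⟩ := Filter.eventually_atTop.1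
    ((tendsto_pow_atTop_atTop_of_one_lt ht1).eventually_gt_atTop (2 / q l₀))
  refine ⟨M, t, 2 / (s₁ * s₂ * D), ht1, by positivity, fun m hm => ?_⟩
  let f : ℝ → ℝ := fun l => (-1) ^ m * (2 * (2 * (chainState (defectSpacing m s₁ s₂) l (2 * m)).2
      - l * (chainState (defectSpacing m s₁ s₂) l (2 * m)).1))
  have hf : Continuous f := by
    rw [continuous_iff_continuousAt]
    intro x
    obtain ⟨a', y', ha, hy, -⟩ := exists_hasDerivAt_chainState (defectSpacing m s₁ s₂) x (2 * m)
    exact continuousAt_const.mul (continuousAt_const.mul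
      ((continuousAt_const.mul hy.continuousAt).sub (continuousAt_id.mul ha.continuousAt)))
  have hid : ∀ l, cellUpper s₁ s₂ l * (((4 - s₂ * l) * (cellState s₁ s₂ l m).2) ^ 2
        - (2 * l * (cellState s₁ s₂ l m).1) ^ 2)
      = l * (4 * q l * (cellState s₁ s₂ l m).1 ^ 2 - (4 - s₂ * l) ^ 2 * (2 - s₁ * l)) :=
    fun l => matching_identity s₁ s₂ l m
  have hnn : ∀ l, l₀ ≤ l → l ≤ L → 0 ≤ (4 - s₂ * l) * (cellState s₁ s₂ l m).2 ∧
      0 < 2 * l * (cellState s₁ s₂ l m).1 ∧ 0 < cellUpper s₁ s₂ l ∧ 0 < l := by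
    intro l h h'
    obtain ⟨h1, h2⟩ := cellState_nonneg hs₁ hs₂ (hmem l h h') m
    have h0 := (mul_lt_of_mem_bandGap hs₁ hs₂ (hmem l h h')).1
    have e2 : s₂ * l ≤ s₂ * L := mul_le_mul_of_nonneg_left h' h2pos.le
    exact ⟨mul_nonneg (by linarith) h2, by positivity, cellUpper_pos hs₁ hs₂ (hmem l h h'), h0⟩
  have hf0 : 0 < f l₀ := by
    obtain ⟨n1, n2, n3, n4⟩ := hnn l₀ le_rfl hl₀L.le
    simp only [f]
    rw [matching_eq, sub_pos]
    refine lt_of_pow_lt_pow_left₀ 2 n1 ?_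
    have h8 := (hrhs l₀ le_rfl hl₀L.le).2
    have hg := hgrow l₀ le_rfl hl₀L.le m
    have hM' := hM m hm
    rw [div_lt_iff₀ hq0] at hM'
    have h9 : t ^ m * q l₀ ≤ (cellState s₁ s₂ l₀ m).1 ^ 2 * q l₀ :=
      mul_le_mul_of_nonneg_right hg hq0.le
    have h10 : 0 < l₀ * (4 * q l₀ * (cellState s₁ s₂ l₀ m).1 ^ 2
        - (4 - s₂ * l₀) ^ 2 * (2 - s₁ * l₀)) := mul_pos n4 (by linarith)
    rw [← hid] at h10
    linarith [(pos_iff_pos_of_mul_pos h10).1 n3]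
  have hfL : f L < 0 := by
    obtain ⟨n1, n2, n3, n4⟩ := hnn L hl₀L.le le_rfl
    simp only [f]
    rw [matching_eq, sub_neg]
    refine lt_of_pow_lt_pow_left₀ 2 n2.le ?_
    have h8 := (hrhs L hl₀L.le le_rfl).1
    have hqL : q L = 0 := by
      simp only [hq]
      rw [hfac]
      ring
    have h10 := hid L
    rw [hqL] at h10
    have h11 : 0 < cellUpper s₁ s₂ L * ((2 * L * (cellState s₁ s₂ L m).1) ^ 2
        - ((4 - s₂ * L) * (cellState s₁ s₂ L m).2) ^ 2) := by
      have := mul_pos n4 h8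
      linarith
    linarith [(pos_iff_pos_of_mul_pos h11).1 n3]
  obtain ⟨l, ⟨hl1, hl2⟩, hfl⟩ := intermediate_value_Ioo' hl₀L.le hf.continuousOn ⟨hfL, hf0⟩
  refine ⟨l, hmem l hl1.le hl2.le, ?_, htr l hl1.le hl2.le, ?_⟩
  · have h1 : ((-1 : ℝ) ^ m) ≠ 0 := by simp
    have := (mul_eq_zero.1 hfl).resolve_left h1
    linarith
  · obtain ⟨n1, n2, n3, n4⟩ := hnn l hl1.le hl2.le
    have h8 := (hrhs l hl1.le hl2.le).2
    have hg := hgrow l hl1.le hl2.le m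
    have e := matching_eq s₁ s₂ l m
    have hfl' : (4 - s₂ * l) * (cellState s₁ s₂ l m).2 = 2 * l * (cellState s₁ s₂ l m).1 := by
      have : f l = _ := e
      rw [hfl] at this
      linarith
    have h10 := hid l
    rw [hfl', sub_self, mul_zero] at h10
    have h11 := (mul_eq_zero.1 h10.symm).resolve_left n4.ne'
    have hql : s₁ * s₂ * D * (L - l) ≤ q l := by
      simp only [hq]
      rw [hfac]
      have h12 : (L - l) * D ≤ (L - l) * (L + D - l) :=
        mul_le_mul_of_nonneg_left (by linarith) (by linarith)
      have := mul_le_mul_of_nonneg_left h12 (mul_pos hs₁ h2pos).le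
      linarith
    have htm : 0 < t ^ m := by positivity
    have hql0 : 0 ≤ q l := by
      refine le_trans ?_ hql
      have : 0 < L - l := by linarith
      positivity
    have h13 : q l * t ^ m ≤ q l * (cellState s₁ s₂ l m).1 ^ 2 :=
      mul_le_mul_of_nonneg_left hg hql0
    have h14 := mul_le_mul_of_nonneg_right hql htm.le
    rw [abs_of_pos (by linarith), ← div_eq_mul_inv, lt_div_iff₀ htm, lt_div_iff₀ (by positivity)]
    linarith

/-! ### Eigenspaces and decay of eigenvectors -/

lemma hasEigenvalue_capacitanceMatrix_iff {s : ℕ → ℝ} {N : ℕ} (hN : 0 < N)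
    (hs : ∀ i, 0 < s i) (mu : ℝ) :
    Module.End.HasEigenvalue (Matrix.toLin' (capacitanceMatrix s N)) mu
      ↔ (chainState s mu N).2 = 0 := by
  constructor
  · intro h
    obtain ⟨a, ha⟩ := h.exists_hasEigenvector
    have h1 := ha.apply_eq_smul
    rw [Matrix.toLin'_apply, capacitanceMatrix_mulVec_eq_smul_iff hN hs] at h1
    refine (mul_eq_zero.1 h1.2).resolve_left fun h0 => ha.2 ?_
    ext i
    rw [h1.1 i, h0]
    simp
  · intro h
    apply Module.End.hasEigenvalue_of_hasEigenvector (x := fun i : Fin N => (chainState s mu i).1)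
    refine ⟨?_, ?_⟩
    · rw [Module.End.mem_eigenspace_iff, Matrix.toLin'_apply,
        capacitanceMatrix_mulVec_eq_smul_iff hN hs]
      simp [h]
    · intro h0
      have := congrFun h0 ⟨0, hN⟩
      simp at this

lemma finrank_eigenspace_capacitanceMatrix {s : ℕ → ℝ} {N : ℕ} (hN : 0 < N)
    (hs : ∀ i, 0 < s i) {mu : ℝ} (h : (chainState s mu N).2 = 0) :
    Module.finrank ℝ (Module.End.eigenspace
      (Matrix.toLin' (capacitanceMatrix s N)) mu) = 1 := by
  have hmem : (fun i : Fin N => (chainState s mu i).1) ∈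
      Module.End.eigenspace (Matrix.toLin' (capacitanceMatrix s N)) mu := by
    rw [Module.End.mem_eigenspace_iff, Matrix.toLin'_apply,
      capacitanceMatrix_mulVec_eq_smul_iff hN hs]
    simp [h]
  apply finrank_eq_one (⟨_, hmem⟩ : Module.End.eigenspace
      (Matrix.toLin' (capacitanceMatrix s N)) mu)
  · intro h0
    have := congrFun (congrArg Subtype.val h0) ⟨0, hN⟩
    simp at this
  · rintro ⟨a, ha⟩
    rw [Module.End.mem_eigenspace_iff, Matrix.toLin'_apply,
      capacitanceMatrix_mulVec_eq_smul_iff hN hs] at ha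
    refine ⟨a ⟨0, hN⟩, ?_⟩
    ext i
    simp [ha.1 i]

/-- The solution of the matching problem at the interface decays exponentially on both sides. -/
lemma abs_chainState_le_exp {s₁ s₂ l : ℝ} (hs₁ : 0 < s₁) (hs₂ : s₁ < s₂) (hl : l ∈ bandGap s₁ s₂)
    {κ : ℝ} (hκ : 0 ≤ κ) (ht : Real.exp (2 * κ) ≤ cellTrace s₁ s₂ l) {m : ℕ}
    (hroot : 2 * (chainState (defectSpacing m s₁ s₂) l (2 * m)).2
      = l * (chainState (defectSpacing m s₁ s₂) l (2 * m)).1) {n : ℕ} (hn : n ≤ 4 * m) :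
    |(chainState (defectSpacing m s₁ s₂) l n).1|
      ≤ Real.exp κ * Real.exp (-κ * |(n : ℝ) - 2 * m|)
        * |(chainState (defectSpacing m s₁ s₂) l (2 * m)).1| := by
  wlog h : n ≤ 2 * m generalizing n
  · have hsym := (chainState_symm_of_center _ l (defectSpacing_symm s₁ s₂ m) hroot (n - 2 * m)
      (by omega)).1
    rw [show 2 * m + (n - 2 * m) = n by omega] at hsym
    rw [hsym]
    refine (this (n := 2 * m - (n - 2 * m)) (by omega) (by omega)).trans_eq ?_
    rw [show ((2 * m - (n - 2 * m) : ℕ) : ℝ) = 4 * m - n by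
      rw [show 2 * m - (n - 2 * m) = 4 * m - n by omega, Nat.cast_sub hn]; push_cast; ring,
      show (4 * m - n : ℝ) - 2 * m = -(n - 2 * m) by ring, abs_neg]
  obtain ⟨j, hj, hnj⟩ : ∃ j ≤ m, n = 2 * j ∨ n + 1 = 2 * j :=
    ⟨(n + 1) / 2, by omega, by omega⟩
  have key := abs_chainState_le hs₁ hs₂ hl (Real.one_le_exp (by linarith)) ht hj hnj
  have habs : |(n : ℝ) - 2 * m| = 2 * m - n := by
    have : (n : ℝ) ≤ 2 * m := by exact_mod_cast h
    rw [abs_of_nonpos (by linarith)]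
    ring
  have hjn : (2 * j : ℝ) ≤ n + 1 := by
    have : 2 * j ≤ n + 1 := by omega
    exact_mod_cast this
  rw [← Real.exp_nat_mul, Nat.cast_sub hj] at key
  rw [habs, ← Real.exp_add]
  have hexp : Real.exp (-(((m : ℝ) - j) * (2 * κ))) ≤ Real.exp (κ + -κ * (2 * m - n)) := by
    apply Real.exp_le_exp.2
    nlinarith
  calc |(chainState (defectSpacing m s₁ s₂) l n).1|
      = Real.exp (-(((m : ℝ) - j) * (2 * κ))) * (Real.exp (((m : ℝ) - j) * (2 * κ))
        * |(chainState (defectSpacing m s₁ s₂) l n).1|) := by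
        rw [← mul_assoc, ← Real.exp_add, neg_add_cancel, Real.exp_zero, one_mul]
    _ ≤ _ := mul_le_mul hexp key (by positivity) (Real.exp_nonneg _)

/-! ### Waves in a homogeneous medium -/

/-- The entire function `sin z / z`. -/
noncomputable def csinc : ℂ → ℂ := dslope Complex.sin 0

@[simp] lemma csinc_zero : csinc 0 = 1 := by simp [csinc]

lemma mul_csinc (z : ℂ) : z * csinc z = Complex.sin z := by
  have := sub_smul_dslope Complex.sin 0 z
  simpa [csinc] using this

lemma contDiff_csinc : ContDiff ℂ 1 csinc := by
  have h : DifferentiableOn ℂ csinc univ :=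
    (Complex.differentiableOn_dslope univ_mem).2 Complex.differentiable_sin.differentiableOn
  exact (differentiableOn_univ.1 h).contDiff

/-- The solution of `u'' = -k ^ 2 u` with `u 0 = a` and `u' 0 = p`; it depends analytically on all
parameters, also at `k = 0`. -/
noncomputable def wave (k a p : ℂ) (t : ℝ) : ℂ :=
  a * Complex.cos (k * t) + p * (t * csinc (k * t))

@[simp] lemma wave_zero (k a p : ℂ) : wave k a p 0 = a := by simp [wave]

lemma wave_mul (k c a p : ℂ) (t : ℝ) : wave k (c * a) (c * p) t = c * wave k a p t := by
  unfold wave; ring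

lemma wave_I (k c : ℂ) (t : ℝ) :
    wave k c (Complex.I * k * c) t = c * Complex.exp (Complex.I * k * t) := by
  have h := mul_csinc (k * t)
  rw [show Complex.I * k * t = (k * t) * Complex.I by ring, Complex.exp_mul_I, ← h, wave]
  ring

lemma wave_neg_I (k c : ℂ) (t : ℝ) :
    wave k c (-Complex.I * k * c) t = c * Complex.exp (-Complex.I * k * t) := by
  have h := mul_csinc (k * t)
  rw [show -Complex.I * k * t = (-(k * t)) * Complex.I by ring, Complex.exp_mul_I, Complex.cos_neg,
    Complex.sin_neg, ← h, wave]
  ring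

lemma hasDerivAt_wave (k a p : ℂ) (x₀ x : ℝ) :
    HasDerivAt (fun x => wave k a p (x - x₀)) (wave k p (-(k ^ 2 * a)) (x - x₀)) x := by
  have hlin : ∀ z : ℂ, HasDerivAt (fun z : ℂ => k * z) k z := fun z => by
    simpa using (hasDerivAt_id z).const_mul k
  have hsin : ∀ z : ℂ, HasDerivAt (fun z => z * csinc (k * z)) (Complex.cos (k * z)) z := by
    intro z
    by_cases hk : k = 0
    · subst hk
      simpa using hasDerivAt_id' z
    · have h1 := ((hlin z).csin).div_const k
      have h2 : (fun z => z * csinc (k * z)) = fun z => Complex.sin (k * z) / k := by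
        ext w
        rw [← mul_csinc]
        field_simp
      rw [h2]
      rw [mul_div_cancel_right₀ _ hk] at h1
      exact h1
  have hcos : ∀ z : ℂ, HasDerivAt (fun z => Complex.cos (k * z))
      (-(k ^ 2) * (z * csinc (k * z))) z := by
    intro z
    convert (hlin z).ccos using 1
    rw [← mul_csinc]
    ring
  have h := (((hcos ((x - x₀ : ℝ) : ℂ)).const_mul a).add
    ((hsin ((x - x₀ : ℝ) : ℂ)).const_mul p)).comp_ofReal
  have h' := h.comp_sub_const x x₀
  refine h'.congr_deriv ?_
  unfold wave
  ring

lemma wave_second (k a p : ℂ) (t : ℝ) :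
    wave k (-(k ^ 2 * a)) (-(k ^ 2 * p)) t = -k ^ 2 * wave k a p t := by
  unfold wave; ring

lemma continuous_wave (k a p : ℂ) (x₀ : ℝ) : Continuous fun x => wave k a p (x - x₀) :=
  continuous_iff_continuousAt.2 fun x => (hasDerivAt_wave k a p x₀ x).continuousAt

lemma deriv_wave (k a p : ℂ) (x₀ : ℝ) : deriv (fun x => wave k a p (x - x₀))
    = fun x => wave k p (-(k ^ 2 * a)) (x - x₀) :=
  funext fun x => (hasDerivAt_wave k a p x₀ x).deriv

/-- `u` satisfies the equation `u'' = c u` at the point `x`. -/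
def SolvesAt (c : ℂ) (u : ℝ → ℂ) (x : ℝ) : Prop :=
  DifferentiableAt ℝ u x ∧ HasDerivAt (deriv u) (c * u x) x

lemma SolvesAt.congr {c : ℂ} {u w : ℝ → ℂ} {x : ℝ} (h : SolvesAt c u x) (he : w =ᶠ[𝓝 x] u) :
    SolvesAt c w x := by
  refine ⟨he.differentiableAt_iff.2 h.1, ?_⟩
  rw [he.eq_of_nhds]
  exact h.2.congr_of_eventuallyEq he.deriv

lemma solvesAt_wave (k a p : ℂ) (x₀ x : ℝ) :
    SolvesAt (-k ^ 2) (fun x => wave k a p (x - x₀)) x := by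
  refine ⟨(hasDerivAt_wave k a p x₀ x).differentiableAt, ?_⟩
  rw [deriv_wave, ← wave_second]
  exact hasDerivAt_wave _ _ _ _ _

/-- A function with vanishing derivative is equal to its limit along any filter on its domain, in
particular to its one-sided limit at an end point. -/
lemma eq_of_hasDerivAt_zero_of_tendsto {f : ℝ → ℂ} {S : Set ℝ} (hS : IsOpen S)
    (hS' : IsPreconnected S) (hf : ∀ x ∈ S, HasDerivAt f 0 x) {l : Filter ℝ} [l.NeBot]
    (hl : S ∈ l) {c : ℂ} (hc : Tendsto f l (𝓝 c)) {x : ℝ} (hx : x ∈ S) : f x = c := by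
  have h : ∀ y ∈ S, f y = f x := fun y hy =>
    hS.is_const_of_deriv_eq_zero hS' (fun z hz => (hf z hz).differentiableAt.differentiableWithinAt)
      (fun z hz => (hf z hz).deriv) hy hx
  refine tendsto_nhds_unique (tendsto_const_nhds.congr' ?_) hc
  filter_upwards [hl] with y hy using (h y hy).symm

/-- Uniqueness for the initial value problem with data given as one-sided limits. -/
lemma eq_wave_of_solvesAt {k q : ℂ} {w : ℝ → ℂ} (hw : Continuous w) {a b : ℝ} (hab : a < b)
    (h : ∀ x ∈ Ioo a b, SolvesAt (-k ^ 2) w x) (hq : Tendsto (deriv w) (𝓝[>] a) (𝓝 q)) :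
    ∀ x ∈ Icc a b, w x = wave k (w a) q (x - a) := by
  -- the two coefficients of `w` in the basis of waves from `a` are constant
  have hC : ∀ x, HasDerivAt (fun x => wave k 1 0 (x - a)) (-k ^ 2 * wave k 0 1 (x - a)) x := by
    intro x
    convert hasDerivAt_wave k 1 0 a x using 1
    unfold wave; ring
  have hS : ∀ x, HasDerivAt (fun x => wave k 0 1 (x - a)) (wave k 1 0 (x - a)) x := by
    intro x
    convert hasDerivAt_wave k 0 1 a x using 1
    unfold wave; ring
  have hpyth : ∀ t : ℝ, wave k 1 0 t ^ 2 + k ^ 2 * wave k 0 1 t ^ 2 = 1 := by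
    intro t
    have h1 := Complex.sin_sq_add_cos_sq (k * t)
    rw [← mul_csinc] at h1
    unfold wave
    linear_combination h1
  have hlim : ∀ {f : ℝ → ℂ}, Continuous f → Tendsto f (𝓝[>] a) (𝓝 (f a)) := fun hf =>
    hf.continuousAt.tendsto.mono_left nhdsWithin_le_nhds
  have hCl := hlim (continuous_wave k 1 0 a)
  have hSl := hlim (continuous_wave k 0 1 a)
  simp only [sub_self, wave_zero] at hCl hSl
  have hmem : Ioo a b ∈ 𝓝[>] a := Ioo_mem_nhdsGT hab
  have e1 : ∀ x ∈ Ioo a b,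
      w x * wave k 1 0 (x - a) - deriv w x * wave k 0 1 (x - a) = w a := by
    intro x hx
    refine eq_of_hasDerivAt_zero_of_tendsto (l := 𝓝[>] a)
      (f := fun x => w x * wave k 1 0 (x - a) - deriv w x * wave k 0 1 (x - a))
      isOpen_Ioo isPreconnected_Ioo (fun y hy => ?_) hmem ?_ hx
    · refine (((h y hy).1.hasDerivAt.mul (hC y)).sub ((h y hy).2.mul (hS y))).congr_deriv ?_
      ring
    · simpa using ((hlim hw).mul hCl).sub (hq.mul hSl)
  have e2 : ∀ x ∈ Ioo a b,
      k ^ 2 * (w x * wave k 0 1 (x - a)) + deriv w x * wave k 1 0 (x - a) = q := by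
    intro x hx
    refine eq_of_hasDerivAt_zero_of_tendsto (l := 𝓝[>] a)
      (f := fun x => k ^ 2 * (w x * wave k 0 1 (x - a)) + deriv w x * wave k 1 0 (x - a))
      isOpen_Ioo isPreconnected_Ioo (fun y hy => ?_) hmem ?_ hx
    · refine ((((h y hy).1.hasDerivAt.mul (hS y)).const_mul (k ^ 2)).add
        ((h y hy).2.mul (hC y))).congr_deriv ?_
      ring
    · simpa using (((hlim hw).mul hSl).const_mul (k ^ 2)).add (hq.mul hCl)
  have e3 : EqOn w (fun x => wave k (w a) q (x - a)) (Ioo a b) := by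
    intro x hx
    have h1 := e1 x hx
    have h2 := e2 x hx
    have h3 : wave k (w a) q (x - a) = w a * wave k 1 0 (x - a) + q * wave k 0 1 (x - a) := by
      unfold wave; ring
    simp only [h3]
    linear_combination -w x * hpyth (x - a) + wave k 1 0 (x - a) * h1 + wave k 0 1 (x - a) * h2
  have e4 := e3.closure hw (continuous_wave k (w a) q a)
  rw [closure_Ioo hab.ne] at e4
  exact e4

lemma tendsto_deriv_of_eq_wave {k α p : ℂ} {x₀ a b : ℝ} {w : ℝ → ℂ} (hab : a < b)
    (h : ∀ x ∈ Ioo a b, w x = wave k α p (x - x₀)) :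
    Tendsto (deriv w) (𝓝[>] a) (𝓝 (wave k p (-(k ^ 2 * α)) (a - x₀))) ∧
      Tendsto (deriv w) (𝓝[<] b) (𝓝 (wave k p (-(k ^ 2 * α)) (b - x₀))) := by
  have h1 : ∀ x ∈ Ioo a b, deriv w x = wave k p (-(k ^ 2 * α)) (x - x₀) := by
    intro x hx
    have : w =ᶠ[𝓝 x] fun x => wave k α p (x - x₀) := by
      filter_upwards [isOpen_Ioo.mem_nhds hx] with y hy using h y hy
    rw [this.deriv_eq, deriv_wave]
  have hc := continuous_wave k p (-(k ^ 2 * α)) x₀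
  constructor
  · refine (hc.continuousAt.tendsto.mono_left nhdsWithin_le_nhds).congr' ?_
    filter_upwards [Ioo_mem_nhdsGT hab] with x hx using (h1 x hx).symm
  · refine (hc.continuousAt.tendsto.mono_left nhdsWithin_le_nhds).congr' ?_
    filter_upwards [Ioo_mem_nhdsLT hab] with x hx using (h1 x hx).symm

/-! ### The exact transfer recursion -/

/-- Value and exterior slope at the right end of a resonator, in terms of those at its left end.
Here `lam` stands for `k ^ 2 / δ`, which has to be kept finite as `δ → 0`. -/
noncomputable def resonatorExit (δ k lam : ℂ) (e : ℂ × ℂ) : ℂ × ℂ :=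
  (wave k e.1 (δ * e.2) 1, wave k e.2 (-(lam * e.1)) 1)

/-- Value and exterior slope at the left end of the resonator `n + 1` for the solution that is
outgoing on the left, normalised by the value `1` at the left end of the chain. -/
noncomputable def entryState (s : ℕ → ℝ) (δ k k₀ lam : ℂ) : ℕ → ℂ × ℂ
  | 0 => (1, -Complex.I * k₀)
  | n + 1 =>
    (wave k₀ (resonatorExit δ k lam (entryState s δ k k₀ lam n)).1
        (resonatorExit δ k lam (entryState s δ k k₀ lam n)).2 (s (n + 1)),
      wave k₀ (resonatorExit δ k lam (entryState s δ k k₀ lam n)).2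
        (-(k₀ ^ 2 * (resonatorExit δ k lam (entryState s δ k k₀ lam n)).1)) (s (n + 1)))

/-- Value and exterior slope of the same solution at the right end of the resonator `n + 1`. -/
noncomputable def exitState (s : ℕ → ℝ) (δ k k₀ lam : ℂ) (n : ℕ) : ℂ × ℂ :=
  resonatorExit δ k lam (entryState s δ k k₀ lam n)

/-- The exterior wave behind the first `n` resonators. -/
noncomputable def tailWave (s : ℕ → ℝ) (δ k k₀ lam : ℂ) : ℕ → ℝ → ℂ
  | 0 => fun x => wave k₀ 1 (-Complex.I * k₀) (x - 0)
  | n + 1 => fun x => wave k₀ (exitState s δ k k₀ lam n).1 (exitState s δ k k₀ lam n).2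
      (x - rightEnd s (n + 1))

/-- The solution for the chain of the first `n` resonators that is outgoing on the left and takes
the value `1` at `0`. Each step changes it only to the right of
the left end of the resonator that is added. -/
noncomputable def shotMode (s : ℕ → ℝ) (δ k k₀ lam : ℂ) : ℕ → ℝ → ℂ
  | 0 => tailWave s δ k k₀ lam 0
  | n + 1 => fun x =>
      if x ≤ leftEnd s (n + 1) then shotMode s δ k k₀ lam n x
      else if x ≤ rightEnd s (n + 1) then
        wave k (entryState s δ k k₀ lam n).1 (δ * (entryState s δ k k₀ lam n).2)
          (x - leftEnd s (n + 1))
      else tailWave s δ k k₀ lam (n + 1) x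

section Geometry

variable {s : ℕ → ℝ}

@[simp] lemma leftEnd_one (s : ℕ → ℝ) : leftEnd s 1 = 0 := by simp [leftEnd]

lemma leftEnd_succ_succ (s : ℕ → ℝ) (n : ℕ) :
    leftEnd s (n + 1 + 1) = rightEnd s (n + 1) + s (n + 1) := by
  unfold rightEnd leftEnd
  rw [Finset.sum_Ico_succ_top (by omega)]
  ring

lemma leftEnd_lt_rightEnd (s : ℕ → ℝ) (n : ℕ) : leftEnd s n < rightEnd s n := by
  unfold rightEnd; linarith

lemma rightEnd_lt_leftEnd (hs : ∀ i, 0 < s i) (n : ℕ) :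
    rightEnd s (n + 1) < leftEnd s (n + 1 + 1) := by
  rw [leftEnd_succ_succ]; linarith [hs (n + 1)]

lemma leftEnd_mono (hs : ∀ i, 0 < s i) : Monotone (leftEnd s) := by
  intro i j hij
  unfold leftEnd
  apply Finset.sum_le_sum_of_subset_of_nonneg
  · exact Finset.Ico_subset_Ico_right hij
  · intro k _ _
    linarith [hs k]

lemma rightEnd_mono (hs : ∀ i, 0 < s i) : Monotone (rightEnd s) := fun _ _ h =>
  add_le_add_left (leftEnd_mono hs h) 1

lemma mem_resonators {N : ℕ} {x : ℝ} : x ∈ resonators s N ↔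
    ∃ i, (1 ≤ i ∧ i ≤ N) ∧ x ∈ Ioo (leftEnd s i) (rightEnd s i) := by
  simp only [resonators, mem_iUnion, Finset.mem_Icc, exists_prop]

lemma mem_closedResonators {N : ℕ} {x : ℝ} : x ∈ closedResonators s N ↔
    ∃ i, (1 ≤ i ∧ i ≤ N) ∧ x ∈ Icc (leftEnd s i) (rightEnd s i) := by
  simp only [closedResonators, mem_iUnion, Finset.mem_Icc, exists_prop]

lemma notMem_closedResonators_of_gap (hs : ∀ i, 0 < s i) {N n : ℕ} {x : ℝ}
    (h1 : rightEnd s (n + 1) < x) (h2 : x < leftEnd s (n + 1 + 1)) :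
    x ∉ closedResonators s N := by
  rw [mem_closedResonators]
  rintro ⟨i, -, h⟩
  rcases Nat.lt_or_ge (n + 1) i with hi | hi
  · linarith [leftEnd_mono hs (show n + 1 + 1 ≤ i from hi), h.1]
  · linarith [rightEnd_mono hs hi, h.2]

lemma notMem_closedResonators_of_neg (hs : ∀ i, 0 < s i) {N : ℕ} {x : ℝ}
    (h : x < leftEnd s 1) : x ∉ closedResonators s N := by
  rw [mem_closedResonators]
  rintro ⟨i, hi, hx⟩
  linarith [leftEnd_mono hs hi.1, hx.1]

lemma notMem_closedResonators_of_gt (hs : ∀ i, 0 < s i) {N : ℕ} {x : ℝ}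
    (h : rightEnd s N < x) : x ∉ closedResonators s N := by
  rw [mem_closedResonators]
  rintro ⟨i, hi, hx⟩
  linarith [rightEnd_mono hs hi.2, hx.2]

end Geometry

/-! ### Modes obtained by shooting -/

section Mode

variable {s : ℕ → ℝ} {δ k k₀ lam : ℂ}

/-- The slope of `tailWave`. -/
noncomputable def tailSlope (s : ℕ → ℝ) (δ k k₀ lam : ℂ) : ℕ → ℝ → ℂ
  | 0 => fun x => wave k₀ (-Complex.I * k₀) (-(k₀ ^ 2 * 1)) (x - 0)
  | n + 1 => fun x => wave k₀ (exitState s δ k k₀ lam n).2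
      (-(k₀ ^ 2 * (exitState s δ k k₀ lam n).1)) (x - rightEnd s (n + 1))

lemma exists_tailWave_eq (s : ℕ → ℝ) (δ k k₀ lam : ℂ) (n : ℕ) : ∃ α p x₀,
    tailWave s δ k k₀ lam n = (fun x => wave k₀ α p (x - x₀)) ∧
    tailSlope s δ k k₀ lam n = fun x => wave k₀ p (-(k₀ ^ 2 * α)) (x - x₀) := by
  cases n with
  | zero => exact ⟨_, _, _, rfl, rfl⟩
  | succ n => exact ⟨_, _, _, rfl, rfl⟩

lemma tailWave_leftEnd (s : ℕ → ℝ) (δ k k₀ lam : ℂ) (n : ℕ) :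
    (tailWave s δ k k₀ lam n (leftEnd s (n + 1)), tailSlope s δ k k₀ lam n (leftEnd s (n + 1)))
      = entryState s δ k k₀ lam n := by
  cases n with
  | zero => simp [tailWave, tailSlope, entryState]
  | succ n =>
    simp only [tailWave, tailSlope, entryState, leftEnd_succ_succ, add_sub_cancel_left, exitState]

lemma continuous_tailWave (n : ℕ) : Continuous (tailWave s δ k k₀ lam n) := by
  obtain ⟨α, p, x₀, h, -⟩ := exists_tailWave_eq s δ k k₀ lam n
  rw [h]
  exact continuous_wave _ _ _ _

/-- The wave inside the resonator `n + 1`. -/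
noncomputable def innerWave (s : ℕ → ℝ) (δ k k₀ lam : ℂ) (n : ℕ) (x : ℝ) : ℂ :=
  wave k (entryState s δ k k₀ lam n).1 (δ * (entryState s δ k k₀ lam n).2) (x - leftEnd s (n + 1))

lemma shotMode_of_le_leftEnd {n : ℕ} {x : ℝ} (h : x ≤ leftEnd s (n + 1)) :
    shotMode s δ k k₀ lam (n + 1) x = shotMode s δ k k₀ lam n x := by
  simp only [shotMode, if_pos h]

lemma shotMode_of_gt_rightEnd {n : ℕ} {x : ℝ} (h : rightEnd s (n + 1) < x) :
    shotMode s δ k k₀ lam (n + 1) x = tailWave s δ k k₀ lam (n + 1) x := by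
  have := leftEnd_lt_rightEnd s (n + 1)
  simp only [shotMode, if_neg (not_le.2 (this.trans h)), if_neg (not_le.2 h)]

lemma innerWave_rightEnd (n : ℕ) : innerWave s δ k k₀ lam n (rightEnd s (n + 1))
    = tailWave s δ k k₀ lam (n + 1) (rightEnd s (n + 1)) := by
  simp [innerWave, tailWave, exitState, resonatorExit, rightEnd]

lemma exists_shotMode_eq_tailWave (hs : ∀ i, 0 < s i) (n : ℕ) : ∃ c < leftEnd s (n + 1),
    ∀ x > c, shotMode s δ k k₀ lam n x = tailWave s δ k k₀ lam n x := by
  cases n with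
  | zero => exact ⟨-1, by simp, fun x _ => rfl⟩
  | succ n =>
    exact ⟨rightEnd s (n + 1), rightEnd_lt_leftEnd hs n, fun x hx => shotMode_of_gt_rightEnd hx⟩

lemma shotMode_leftEnd (hs : ∀ i, 0 < s i) (n : ℕ) :
    shotMode s δ k k₀ lam n (leftEnd s (n + 1)) = (entryState s δ k k₀ lam n).1 := by
  obtain ⟨c, hc, h⟩ := exists_shotMode_eq_tailWave (δ := δ) (k := k) (k₀ := k₀) (lam := lam) hs n
  rw [h _ hc, ← tailWave_leftEnd]

lemma shotMode_inner (hs : ∀ i, 0 < s i) {n : ℕ} {x : ℝ}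
    (hx : x ∈ Icc (leftEnd s (n + 1)) (rightEnd s (n + 1))) :
    shotMode s δ k k₀ lam (n + 1) x = innerWave s δ k k₀ lam n x := by
  rcases eq_or_lt_of_le hx.1 with h | h
  · rw [← h, shotMode_of_le_leftEnd le_rfl, shotMode_leftEnd hs]
    simp [innerWave]
  · simp only [shotMode, if_neg (not_le.2 h), if_pos hx.2, innerWave]

lemma shotMode_of_le {n N : ℕ} (hs : ∀ i, 0 < s i) (hn : n ≤ N) {x : ℝ}
    (h : x ≤ leftEnd s (n + 1)) :
    shotMode s δ k k₀ lam N x = shotMode s δ k k₀ lam n x := by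
  induction N, hn using Nat.le_induction with
  | base => rfl
  | succ N hN ih =>
    rw [shotMode_of_le_leftEnd (h.trans (leftEnd_mono hs (by omega))), ih]

lemma continuous_shotMode (hs : ∀ i, 0 < s i) (n : ℕ) : Continuous (shotMode s δ k k₀ lam n) := by
  induction n with
  | zero => exact continuous_tailWave 0
  | succ n ih =>
    refine Continuous.if_le ih (Continuous.if_le (continuous_wave _ _ _ _)
      (continuous_tailWave (n + 1)) continuous_id continuous_const ?_) continuous_id
      continuous_const ?_
    · rintro x rfl
      exact innerWave_rightEnd n
    · rintro x rfl
      rw [if_pos (leftEnd_lt_rightEnd s (n + 1)).le, shotMode_leftEnd hs]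
      simp

lemma shotMode_zero (hs : ∀ i, 0 < s i) (n : ℕ) : shotMode s δ k k₀ lam n 0 = 1 := by
  rw [shotMode_of_le hs (Nat.zero_le n) (by simp)]
  simp [shotMode, tailWave]

lemma shotMode_of_nonpos (hs : ∀ i, 0 < s i) (n : ℕ) {x : ℝ} (hx : x ≤ 0) :
    shotMode s δ k k₀ lam n x = wave k₀ 1 (-Complex.I * k₀) (x - 0) := by
  rw [shotMode_of_le hs (Nat.zero_le n) (by simpa using hx)]
  rfl

lemma shotMode_eq_wave (hs : ∀ i, 0 < s i) {n N : ℕ} (hn : n < N) :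
    ∀ x ∈ Ioo (leftEnd s (n + 1)) (rightEnd s (n + 1)), shotMode s δ k k₀ lam N x
      = wave k (entryState s δ k k₀ lam n).1 (δ * (entryState s δ k k₀ lam n).2)
        (x - leftEnd s (n + 1)) := by
  intro x hx
  rw [shotMode_of_le hs (Nat.succ_le_of_lt hn) (hx.2.le.trans (rightEnd_lt_leftEnd hs n).le),
    shotMode_inner hs (Ioo_subset_Icc_self hx)]
  rfl

lemma shotMode_solves_inside (hs : ∀ i, 0 < s i) (n : ℕ) :
    ∀ x ∈ resonators s n, SolvesAt (-k ^ 2) (shotMode s δ k k₀ lam n) x := by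
  intro x hx
  obtain ⟨i, ⟨h1, h2⟩, hx⟩ := mem_resonators.1 hx
  obtain ⟨j, rfl⟩ : ∃ j, i = j + 1 := ⟨i - 1, by omega⟩
  refine (solvesAt_wave k (entryState s δ k k₀ lam j).1 (δ * (entryState s δ k k₀ lam j).2)
    (leftEnd s (j + 1)) x).congr ?_
  filter_upwards [isOpen_Ioo.mem_nhds hx] with y hy using shotMode_eq_wave hs h2 y hy

lemma solvesAt_tailWave (n : ℕ) (x : ℝ) : SolvesAt (-k₀ ^ 2) (tailWave s δ k k₀ lam n) x := by
  obtain ⟨α, p, x₀, h, -⟩ := exists_tailWave_eq s δ k k₀ lam n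
  rw [h]
  exact solvesAt_wave _ _ _ _ _

lemma shotMode_solves_outside (n : ℕ) :
    ∀ x ∉ closedResonators s n, SolvesAt (-k₀ ^ 2) (shotMode s δ k k₀ lam n) x := by
  induction n with
  | zero => exact fun x _ => solvesAt_tailWave 0 x
  | succ n ih =>
    intro x hx
    rw [mem_closedResonators] at hx
    rcases lt_or_ge x (leftEnd s (n + 1)) with h | h
    · refine (ih x ?_).congr ?_
      · rw [mem_closedResonators]
        rintro ⟨i, hi, hxi⟩
        exact hx ⟨i, ⟨hi.1, by omega⟩, hxi⟩
      · filter_upwards [isOpen_Iio.mem_nhds h] with y hy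
        exact shotMode_of_le_leftEnd (le_of_lt hy)
    · rcases lt_or_ge (rightEnd s (n + 1)) x with h' | h'
      · refine SolvesAt.congr (u := tailWave s δ k k₀ lam (n + 1)) (solvesAt_tailWave _ _) ?_
        filter_upwards [isOpen_Ioi.mem_nhds h'] with y hy
        exact shotMode_of_gt_rightEnd hy
      · exact absurd ⟨n + 1, ⟨by omega, le_rfl⟩, h, h'⟩ hx

lemma tendsto_deriv_of_eq_tailWave {n : ℕ} {w : ℝ → ℂ} {a b : ℝ} (hab : a < b)
    (h : ∀ x ∈ Ioo a b, w x = tailWave s δ k k₀ lam n x) :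
    Tendsto (deriv w) (𝓝[>] a) (𝓝 (tailSlope s δ k k₀ lam n a)) ∧
      Tendsto (deriv w) (𝓝[<] b) (𝓝 (tailSlope s δ k k₀ lam n b)) := by
  obtain ⟨α, p, x₀, h1, h2⟩ := exists_tailWave_eq s δ k k₀ lam n
  rw [h1] at h
  rw [h2]
  exact tendsto_deriv_of_eq_wave hab h

lemma shotMode_flux_left (hs : ∀ i, 0 < s i) {n N : ℕ} (hn : n < N) :
    Tendsto (deriv (shotMode s δ k k₀ lam N)) (𝓝[<] leftEnd s (n + 1))
        (𝓝 (entryState s δ k k₀ lam n).2) ∧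
      Tendsto (deriv (shotMode s δ k k₀ lam N)) (𝓝[>] leftEnd s (n + 1))
        (𝓝 (δ * (entryState s δ k k₀ lam n).2)) := by
  constructor
  · obtain ⟨c, hc, h⟩ :=
      exists_shotMode_eq_tailWave (δ := δ) (k := k) (k₀ := k₀) (lam := lam) hs n
    rw [← tailWave_leftEnd]
    refine (tendsto_deriv_of_eq_tailWave hc fun x hx => ?_).2
    rw [shotMode_of_le hs hn.le hx.2.le, h x hx.1]
  · have := (tendsto_deriv_of_eq_wave (leftEnd_lt_rightEnd s (n + 1))
      (shotMode_eq_wave (δ := δ) (k := k) (k₀ := k₀) (lam := lam) hs hn)).1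
    rwa [sub_self, wave_zero] at this

/-- The relation `δ lam = k ^ 2` turns the second component of `resonatorExit` into the exterior
slope. -/
lemma innerSlope_rightEnd (hk : δ * lam = k ^ 2) (e : ℂ × ℂ) :
    wave k (δ * e.2) (-(k ^ 2 * e.1)) 1 = δ * (resonatorExit δ k lam e).2 := by
  rw [resonatorExit, ← wave_mul, ← hk]
  congr 1
  ring

lemma shotMode_flux_right (hs : ∀ i, 0 < s i) (hk : δ * lam = k ^ 2) {n N : ℕ} (hn : n < N) :
    Tendsto (deriv (shotMode s δ k k₀ lam N)) (𝓝[<] rightEnd s (n + 1))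
        (𝓝 (δ * (exitState s δ k k₀ lam n).2)) ∧
      Tendsto (deriv (shotMode s δ k k₀ lam N)) (𝓝[>] rightEnd s (n + 1))
        (𝓝 (exitState s δ k k₀ lam n).2) := by
  constructor
  · have := (tendsto_deriv_of_eq_wave (leftEnd_lt_rightEnd s (n + 1))
      (shotMode_eq_wave (δ := δ) (k := k) (k₀ := k₀) (lam := lam) hs hn)).2
    rwa [show rightEnd s (n + 1) - leftEnd s (n + 1) = 1 by unfold rightEnd; ring,
      innerSlope_rightEnd hk] at this
  · have := (tendsto_deriv_of_eq_tailWave (w := shotMode s δ k k₀ lam N) (s := s) (δ := δ) (k := k)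
      (k₀ := k₀) (lam := lam) (n := n + 1) (rightEnd_lt_leftEnd hs n) fun x hx => by
        rw [shotMode_of_le hs (Nat.succ_le_of_lt hn) hx.2.le, shotMode_of_gt_rightEnd hx.1]).1
    simpa [tailSlope] using this

end Mode

/-- If the outgoing condition also holds on the right, the shot solution is a mode. -/
lemma isSolution_shotMode {s : ℕ → ℝ} (hs : ∀ i, 0 < s i) {v vb δ : ℝ} {ω lam : ℂ}
    (hk : (δ : ℂ) * lam = (ω / vb) ^ 2) {n : ℕ}
    (hG : (exitState s δ (ω / vb) (ω / v) lam n).2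
      = Complex.I * (ω / v) * (exitState s δ (ω / vb) (ω / v) lam n).1) :
    IsSolution s (n + 1) v vb δ ω (shotMode s δ (ω / vb) (ω / v) lam (n + 1)) where
  continuous := continuous_shotMode hs _
  inside := by
    rw [← div_pow]
    exact shotMode_solves_inside hs _
  outside := by
    rw [← div_pow]
    exact shotMode_solves_outside _
  flux_left := by
    intro i hi
    rw [Finset.mem_Icc] at hi
    obtain ⟨j, rfl⟩ : ∃ j, i = j + 1 := ⟨i - 1, by omega⟩
    obtain ⟨h1, h2⟩ := shotMode_flux_left (δ := δ) (k := ω / vb) (k₀ := ω / v) (lam := lam) hs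
      (show j < n + 1 by omega)
    exact ⟨_, _, h1, h2, rfl⟩
  flux_right := by
    intro i hi
    rw [Finset.mem_Icc] at hi
    obtain ⟨j, rfl⟩ : ∃ j, i = j + 1 := ⟨i - 1, by omega⟩
    obtain ⟨h1, h2⟩ := shotMode_flux_right (k₀ := ω / v) hs hk (show j < n + 1 by omega)
    exact ⟨_, _, h1, h2, rfl⟩
  radiation_left := by
    intro x hx
    rw [leftEnd_one] at hx
    have he : shotMode s δ (ω / vb) (ω / v) lam (n + 1) =ᶠ[𝓝 x]
        fun x => wave (ω / v) 1 (-Complex.I * (ω / v)) (x - 0) := by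
      filter_upwards [isOpen_Iio.mem_nhds hx] with y hy using
        shotMode_of_nonpos hs _ (le_of_lt hy)
    rw [he.deriv_eq, he.eq_of_nhds, deriv_wave]
    unfold wave
    linear_combination ((ω / v) ^ 2 * ((x - 0 : ℝ) : ℂ) * csinc (ω / v * ((x - 0 : ℝ) : ℂ)))
      * Complex.I_sq
  radiation_right := by
    intro x hx
    have he : shotMode s δ (ω / vb) (ω / v) lam (n + 1) =ᶠ[𝓝 x]
        fun x => wave (ω / v) (exitState s δ (ω / vb) (ω / v) lam n).1
          (exitState s δ (ω / vb) (ω / v) lam n).2 (x - rightEnd s (n + 1)) := by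
      filter_upwards [isOpen_Ioi.mem_nhds hx] with y hy using shotMode_of_gt_rightEnd hy
    rw [he.deriv_eq, he.eq_of_nhds, deriv_wave, hG]
    unfold wave
    linear_combination (-(ω / v) ^ 2 * (exitState s δ (ω / vb) (ω / v) lam n).1
      * ((x - rightEnd s (n + 1) : ℝ) : ℂ) * csinc (ω / v * ((x - rightEnd s (n + 1) : ℝ) : ℂ)))
      * Complex.I_sq

/-- Every solution of the scattering problem is a multiple of the shot solution; if it does not
vanish, the shot solution satisfies the outgoing condition on the right. -/
lemma IsSolution.eq_smul_shotMode {s : ℕ → ℝ} (hs : ∀ i, 0 < s i) {v vb δ : ℝ} {ω lam : ℂ}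
    (hδ : δ ≠ 0) (hk : (δ : ℂ) * lam = (ω / vb) ^ 2) {N : ℕ} {w : ℝ → ℂ}
    (hw : IsSolution s (N + 1) v vb δ ω w) :
    w = w 0 • shotMode s δ (ω / vb) (ω / v) lam (N + 1) ∧
      w 0 * ((exitState s δ (ω / vb) (ω / v) lam N).2
        - Complex.I * (ω / v) * (exitState s δ (ω / vb) (ω / v) lam N).1) = 0 := by
  have hδ' : (δ : ℂ) ≠ 0 := by exact_mod_cast hδ
  set k : ℂ := ω / vb with hkdef
  set k₀ : ℂ := ω / v with hk₀def
  have hin : ∀ x ∈ resonators s (N + 1), SolvesAt (-k ^ 2) w x := by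
    rw [hkdef, div_pow]; exact hw.inside
  have hout : ∀ x ∉ closedResonators s (N + 1), SolvesAt (-k₀ ^ 2) w x := by
    rw [hk₀def, div_pow]; exact hw.outside
  have hcont : ∀ x, Tendsto w (𝓝 x) (𝓝 (w x)) := fun x => hw.continuous.continuousAt
  -- an exterior wave that satisfies a first-order radiation condition is an exponential
  have hrad : ∀ (σ : ℂ) (S : Set ℝ) (l : Filter ℝ) [l.NeBot] (c : ℝ), IsOpen S → IsPreconnected S →
      S ∈ l → l ≤ 𝓝 c → (∀ x ∈ S, DifferentiableAt ℝ w x ∧ deriv w x = σ * w x) →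
      (∀ x ∈ S, w x = w c * Complex.exp (σ * ((x - c : ℝ) : ℂ))) ∧
        Tendsto (deriv w) l (𝓝 (σ * w c)) := by
    intro σ S l _ c hS hS' hSl hlc h
    have hexp : ∀ x : ℝ, HasDerivAt (fun x : ℝ => Complex.exp (-(σ * ((x - c : ℝ) : ℂ))))
        (Complex.exp (-(σ * ((x - c : ℝ) : ℂ))) * -σ) x := by
      intro x
      have h1 : HasDerivAt (fun x : ℝ => ((x - c : ℝ) : ℂ)) 1 x := by
        simpa using ((hasDerivAt_id x).sub_const c).ofReal_comp
      simpa using ((h1.const_mul σ).neg).cexp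
    have hwl : Tendsto w l (𝓝 (w c)) := (hcont c).mono_left hlc
    refine ⟨fun x hx => ?_, ?_⟩
    · have key : w x * Complex.exp (-(σ * ((x - c : ℝ) : ℂ))) = w c := eq_of_hasDerivAt_zero_of_tendsto hS hS'
        (f := fun x => w x * Complex.exp (-(σ * ((x - c : ℝ) : ℂ)))) (fun y hy => ?_) hSl ?_ hx
      · rw [← key, mul_assoc, ← Complex.exp_add, neg_add_cancel, Complex.exp_zero, mul_one]
      · refine ((h y hy).1.hasDerivAt.mul (hexp y)).congr_deriv ?_
        rw [(h y hy).2]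
        ring
      · have h2 := ((hexp c).continuousAt.tendsto).mono_left hlc
        simpa using hwl.mul h2
    · refine (hwl.const_mul σ).congr' ?_
      filter_upwards [hSl] with x hx using (h x hx).2.symm
  have hinner : ∀ n ≤ N,
      ((∀ x ≤ leftEnd s (n + 1), w x = w 0 * shotMode s δ k k₀ lam n x) ∧
        Tendsto (deriv w) (𝓝[<] leftEnd s (n + 1)) (𝓝 (w 0 * (entryState s δ k k₀ lam n).2))) →
      (∀ x ≤ rightEnd s (n + 1), w x = w 0 * shotMode s δ k k₀ lam (n + 1) x) ∧
        w (rightEnd s (n + 1)) = w 0 * (exitState s δ k k₀ lam n).1 ∧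
        Tendsto (deriv w) (𝓝[>] rightEnd s (n + 1))
          (𝓝 (w 0 * (exitState s δ k k₀ lam n).2)) := by
    rintro n hn ⟨h1, h2⟩
    obtain ⟨p, q, hp, hq, hpq⟩ := hw.flux_left (n + 1) (Finset.mem_Icc.2 ⟨by omega, by omega⟩)
    obtain ⟨p', q', hp', hq', hpq'⟩ :=
      hw.flux_right (n + 1) (Finset.mem_Icc.2 ⟨by omega, by omega⟩)
    have hp2 : p = w 0 * (entryState s δ k k₀ lam n).2 := tendsto_nhds_unique hp h2
    have hwL : w (leftEnd s (n + 1)) = w 0 * (entryState s δ k k₀ lam n).1 := by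
      rw [h1 _ le_rfl, shotMode_leftEnd hs]
    have hq2 : q = w 0 * (δ * (entryState s δ k k₀ lam n).2) := by
      rw [hpq, hp2]; ring
    have hI := eq_wave_of_solvesAt hw.continuous (leftEnd_lt_rightEnd s (n + 1))
      (fun x hx => hin x (mem_resonators.2 ⟨n + 1, ⟨by omega, by omega⟩, hx⟩)) hq
    have hder := (tendsto_deriv_of_eq_wave (leftEnd_lt_rightEnd s (n + 1))
      fun x hx => hI x (Ioo_subset_Icc_self hx)).2
    have hI' : ∀ x ∈ Icc (leftEnd s (n + 1)) (rightEnd s (n + 1)),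
        w x = w 0 * innerWave s δ k k₀ lam n x := by
      intro x hx
      rw [hI x hx, hwL, hq2, wave_mul]
      rfl
    have hp3 := tendsto_nhds_unique hp' hder
    rw [hwL, hq2, show rightEnd s (n + 1) - leftEnd s (n + 1) = 1 by unfold rightEnd; ring,
      show -(k ^ 2 * (w 0 * (entryState s δ k k₀ lam n).1))
        = w 0 * -(k ^ 2 * (entryState s δ k k₀ lam n).1) by ring, wave_mul,
      innerSlope_rightEnd hk] at hp3
    have hq3 : q' = w 0 * (exitState s δ k k₀ lam n).2 := by
      apply mul_left_cancel₀ hδ'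
      rw [hpq', hp3, exitState]
      ring
    refine ⟨fun x hx => ?_, ?_, hq3 ▸ hq'⟩
    · rcases le_total x (leftEnd s (n + 1)) with h | h
      · rw [h1 x h, shotMode_of_le_leftEnd h]
      · rw [hI' x ⟨h, hx⟩, shotMode_inner hs ⟨h, hx⟩]
    · rw [hI' _ ⟨(leftEnd_lt_rightEnd s (n + 1)).le, le_rfl⟩, innerWave_rightEnd]
      simp [tailWave]
  have hentry : ∀ n ≤ N,
      (∀ x ≤ leftEnd s (n + 1), w x = w 0 * shotMode s δ k k₀ lam n x) ∧
        Tendsto (deriv w) (𝓝[<] leftEnd s (n + 1)) (𝓝 (w 0 * (entryState s δ k k₀ lam n).2)) := by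
    intro n
    induction n with
    | zero =>
      intro _
      obtain ⟨h1, h2⟩ := hrad (-Complex.I * k₀) (Iio 0) (𝓝[<] 0) 0 isOpen_Iio isPreconnected_Iio
        self_mem_nhdsWithin nhdsWithin_le_nhds (fun x hx => ⟨(hout x
          (notMem_closedResonators_of_neg hs (by simpa using hx))).1, by
          have := hw.radiation_left x (by simpa using hx)
          linear_combination -this⟩)
      rw [zero_add, leftEnd_one]
      refine ⟨fun x hx => ?_, ?_⟩
      · rcases eq_or_lt_of_le hx with rfl | hx
        · rw [shotMode_zero hs, mul_one]
        · have e := wave_neg_I k₀ 1 (x - 0)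
          rw [mul_one, one_mul] at e
          rw [h1 x hx, shotMode_of_nonpos hs 0 hx.le, e]
      · rw [mul_comm]
        exact h2
    | succ n ih =>
      intro hn
      obtain ⟨h1, h2, h3⟩ := hinner n (by omega) (ih (by omega))
      have hI := eq_wave_of_solvesAt hw.continuous (rightEnd_lt_leftEnd hs n)
        (fun x hx => hout x (notMem_closedResonators_of_gap hs hx.1 hx.2)) h3
      have hI' : ∀ x ∈ Icc (rightEnd s (n + 1)) (leftEnd s (n + 1 + 1)),
          w x = w 0 * tailWave s δ k k₀ lam (n + 1) x := by
        intro x hx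
        rw [hI x hx, h2, wave_mul]
        rfl
      refine ⟨fun x hx => ?_, ?_⟩
      · rcases le_or_gt x (rightEnd s (n + 1)) with h | h
        · exact h1 x h
        · rw [hI' x ⟨h.le, hx⟩, shotMode_of_gt_rightEnd h]
      · have hder := (tendsto_deriv_of_eq_wave (rightEnd_lt_leftEnd hs n)
          fun x hx => hI x (Ioo_subset_Icc_self hx)).2
        rw [h2, show -(k₀ ^ 2 * (w 0 * (exitState s δ k k₀ lam n).1))
          = w 0 * -(k₀ ^ 2 * (exitState s δ k k₀ lam n).1) by ring, wave_mul] at hder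
        rw [← tailWave_leftEnd]
        exact hder
  obtain ⟨h1, h2, h3⟩ := hinner N le_rfl (hentry N le_rfl)
  obtain ⟨h4, h5⟩ := hrad (Complex.I * k₀) (Ioi (rightEnd s (N + 1)))
    (𝓝[>] (rightEnd s (N + 1))) (rightEnd s (N + 1)) isOpen_Ioi isPreconnected_Ioi
    self_mem_nhdsWithin nhdsWithin_le_nhds (fun x hx => ⟨(hout x
      (notMem_closedResonators_of_gt hs hx)).1, by
      have := hw.radiation_right x hx
      linear_combination this⟩)
  have h6 := tendsto_nhds_unique h3 h5
  rw [h2] at h6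
  refine ⟨?_, by linear_combination h6⟩
  ext x
  rw [Pi.smul_apply, smul_eq_mul]
  rcases le_or_gt x (rightEnd s (N + 1)) with h | h
  · exact h1 x h
  · rw [h4 x h, shotMode_of_gt_rightEnd h, ← wave_I]
    simp only [tailWave]
    rw [← wave_mul, h2, h6]

/-! ### Small contrast -/

/-- A form of the implicit function theorem for analytic equations in two complex variables at a
simple zero in the second variable. -/
lemma exists_implicit_of_hasDerivAt {G : ℂ × ℂ → ℂ} (hG : ContDiff ℂ 1 G) {ζ₀ d : ℂ}
    (h0 : G (0, ζ₀) = 0) (hd : HasDerivAt (fun ζ => G (0, ζ)) d ζ₀) (hd0 : d ≠ 0) :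
    ∃ ψ : ℂ → ℂ, ψ 0 = ζ₀ ∧ DifferentiableAt ℂ ψ 0 ∧ (∀ᶠ x in 𝓝 0, G (x, ψ x) = 0) ∧
      ∀ᶠ p in 𝓝 ((0 : ℂ), ζ₀), G p = 0 → ψ p.1 = p.2 := by
  have hG' : ContDiffAt ℂ 1 G (0, ζ₀) := hG.contDiffAt
  have hpair : HasDerivAt (fun ζ : ℂ => ((0 : ℂ), ζ)) (0, 1) ζ₀ :=
    (hasDerivAt_const ζ₀ (0 : ℂ)).prodMk (hasDerivAt_id ζ₀)
  have hval : fderiv ℂ G (0, ζ₀) (0, 1) = d :=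
    ((hG'.differentiableAt one_ne_zero).hasFDerivAt.comp_hasDerivAt ζ₀ hpair).unique hd
  have hinv : (fderiv ℂ G (0, ζ₀) ∘L .inr ℂ ℂ ℂ).IsInvertible := by
    refine ⟨ContinuousLinearEquiv.unitsEquivAut ℂ (Units.mk0 d hd0), ?_⟩
    ext
    simp [hval]
  refine ⟨hG'.implicitFunction one_ne_zero hinv, hG'.implicitFunction_apply_self _ hinv,
    (hG'.hasStrictFDerivAt_implicitFunction one_ne_zero hinv).hasFDerivAt.differentiableAt, ?_, ?_⟩
  · simpa [h0] using hG'.eventually_apply_implicitFunction one_ne_zero hinv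
  · filter_upwards [hG'.eventually_apply_eq_iff_implicitFunction one_ne_zero hinv] with p hp h
    exact hp.1 (h.trans h0.symm)

lemma contDiff_wave {k a p : ℂ × ℂ → ℂ} (hk : ContDiff ℂ 1 k) (ha : ContDiff ℂ 1 a)
    (hp : ContDiff ℂ 1 p) (t : ℝ) : ContDiff ℂ 1 fun x => wave (k x) (a x) (p x) t := by
  have h1 : ContDiff ℂ 1 fun x => k x * t := hk.mul contDiff_const
  exact (ha.mul (Complex.contDiff_cos.comp h1)).add
    (hp.mul (contDiff_const.mul (contDiff_csinc.comp h1)))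

/-- The state at the left end of the resonator `n + 1` as an analytic function of `ε = √δ` and
`ζ = ω / √δ`. -/
noncomputable def scaledEntry (s : ℕ → ℝ) (v vb : ℝ) (n : ℕ) (p : ℂ × ℂ) : ℂ × ℂ :=
  entryState s (p.1 ^ 2) (p.1 * p.2 / vb) (p.1 * p.2 / v) ((p.2 / vb) ^ 2) n

/-- The state at the right end of the resonator `n + 1` as an analytic function of `ε = √δ` and
`ζ = ω / √δ`. -/
noncomputable def scaledExit (s : ℕ → ℝ) (v vb : ℝ) (n : ℕ) (p : ℂ × ℂ) : ℂ × ℂ :=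
  exitState s (p.1 ^ 2) (p.1 * p.2 / vb) (p.1 * p.2 / v) ((p.2 / vb) ^ 2) n

/-- The characteristic function of a chain of `n + 1` resonators: its zeros are the frequencies
`ω = ε ζ` at contrast `δ = ε ^ 2`, and at `ε = 0` it is, as a function of `(ζ / vb) ^ 2`, the
characteristic polynomial of the capacitance matrix up to a factor. -/
noncomputable def charFn (s : ℕ → ℝ) (v vb : ℝ) (n : ℕ) (p : ℂ × ℂ) : ℂ :=
  (scaledExit s v vb n p).2 - Complex.I * (p.1 * p.2 / v) * (scaledExit s v vb n p).1

section

variable (s : ℕ → ℝ) (v vb : ℝ)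

lemma contDiff_scaled (n : ℕ) :
    (ContDiff ℂ 1 (fun p => (scaledEntry s v vb n p).1) ∧
      ContDiff ℂ 1 (fun p => (scaledEntry s v vb n p).2)) ∧
    (ContDiff ℂ 1 (fun p => (scaledExit s v vb n p).1) ∧
      ContDiff ℂ 1 (fun p => (scaledExit s v vb n p).2)) := by
  have hprod : ContDiff ℂ 1 fun p : ℂ × ℂ => p.1 * p.2 := contDiff_fst.mul contDiff_snd
  have hk : ∀ c : ℝ, ContDiff ℂ 1 fun p : ℂ × ℂ => p.1 * p.2 / (c : ℂ) := fun c =>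
    hprod.div_const _
  have hl : ContDiff ℂ 1 fun p : ℂ × ℂ => (p.2 / (vb : ℂ)) ^ 2 := (contDiff_snd.div_const _).pow 2
  have hexit : ∀ n, (ContDiff ℂ 1 (fun p => (scaledEntry s v vb n p).1) ∧
      ContDiff ℂ 1 (fun p => (scaledEntry s v vb n p).2)) →
      (ContDiff ℂ 1 (fun p => (scaledExit s v vb n p).1) ∧
      ContDiff ℂ 1 (fun p => (scaledExit s v vb n p).2)) := fun n h =>
    ⟨contDiff_wave (hk vb) h.1 ((contDiff_fst.pow 2).mul h.2) 1,
      contDiff_wave (hk vb) h.2 (hl.mul h.1).neg 1⟩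
  have hentry : (ContDiff ℂ 1 (fun p => (scaledEntry s v vb n p).1) ∧
      ContDiff ℂ 1 (fun p => (scaledEntry s v vb n p).2)) := by
    induction n with
    | zero => exact ⟨contDiff_const, contDiff_const.mul (hk v)⟩
    | succ n ih =>
      obtain ⟨h1, h2⟩ := hexit n ih
      exact ⟨contDiff_wave (hk v) h1 h2 _, contDiff_wave (hk v) h2 (((hk v).pow 2).mul h1).neg _⟩
  exact ⟨hentry, hexit n hentry⟩

lemma contDiff_charFn (n : ℕ) : ContDiff ℂ 1 (charFn s v vb n) := by
  obtain ⟨-, h1, h2⟩ := contDiff_scaled s v vb n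
  exact h2.sub ((contDiff_const.mul ((contDiff_fst.mul contDiff_snd).div_const _)).mul h1)

lemma entryState_zero_contrast (lam : ℂ) (n : ℕ) :
    entryState s 0 0 0 lam n = chainState (fun i => (s i : ℂ)) lam n := by
  induction n with
  | zero => simp [entryState]
  | succ n ih =>
    simp only [entryState, ih, resonatorExit, chainState, wave]
    ext <;> simp <;> ring

lemma scaledEntry_zero (n : ℕ) (ζ : ℂ) :
    scaledEntry s v vb n (0, ζ) = chainState (fun i => (s i : ℂ)) ((ζ / vb) ^ 2) n := by
  simp [scaledEntry, entryState_zero_contrast]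

lemma charFn_zero (n : ℕ) (ζ : ℂ) :
    charFn s v vb n (0, ζ) = (chainState (fun i => (s i : ℂ)) ((ζ / vb) ^ 2) (n + 1)).2 := by
  simp [charFn, scaledExit, exitState, entryState_zero_contrast, resonatorExit, wave, chainState]
  ring

lemma chainState_ofReal (l : ℝ) (n : ℕ) : chainState (fun i => (s i : ℂ)) (l : ℂ) n
    = (((chainState s l n).1 : ℂ), ((chainState s l n).2 : ℂ)) :=
  chainState_map s l Complex.ofRealHom n

variable {s v vb}

lemma ofReal_sqrt_sq {δ : ℝ} (hδ : 0 ≤ δ) : ((√δ : ℝ) : ℂ) ^ 2 = δ := by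
  rw [← Complex.ofReal_pow, Real.sq_sqrt hδ]

lemma scaled_wavenumber {δ : ℝ} (hδ : 0 < δ) (ζ : ℂ) :
    (δ : ℂ) * (ζ / vb) ^ 2 = ((√δ : ℝ) * ζ / vb) ^ 2 := by
  rw [← ofReal_sqrt_sq hδ.le]
  ring

lemma charFn_eq_zero_iff {δ : ℝ} (hδ : 0 < δ) (n : ℕ) (ζ : ℂ) :
    charFn s v vb n ((√δ : ℝ), ζ) = 0 ↔
      (exitState s δ ((√δ : ℝ) * ζ / vb) ((√δ : ℝ) * ζ / v) ((ζ / vb) ^ 2) n).2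
      = Complex.I * ((√δ : ℝ) * ζ / v)
        * (exitState s δ ((√δ : ℝ) * ζ / vb) ((√δ : ℝ) * ζ / v) ((ζ / vb) ^ 2) n).1 := by
  rw [charFn, scaledExit, ofReal_sqrt_sq hδ.le, sub_eq_zero]

lemma charFn_eq_zero_of_isSolution (hs : ∀ i, 0 < s i) {δ : ℝ} (hδ : 0 < δ) {n : ℕ} {ζ : ℂ}
    {w : ℝ → ℂ} (hw : IsSolution s (n + 1) v vb δ ((√δ : ℝ) * ζ) w) (hw0 : w ≠ 0) :
    charFn s v vb n ((√δ : ℝ), ζ) = 0 := by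
  obtain ⟨h1, h2⟩ := hw.eq_smul_shotMode hs hδ.ne' (scaled_wavenumber hδ ζ)
  rw [charFn_eq_zero_iff hδ, ← sub_eq_zero]
  refine (mul_eq_zero.1 h2).resolve_left fun h0 => hw0 ?_
  rw [h1, h0, zero_smul]

/-- A family of frequencies of order `√δ` singles out, in the limit of small contrast, an
eigenvalue of the capacitance matrix. -/
lemma chainState_eq_zero_of_tendsto (hs : ∀ i, 0 < s i) (hvb : 0 < vb) {n : ℕ} {ω : ℝ → ℂ}
    (hω : IsSubwavelengthEigenfrequency s (n + 1) v vb ω) {mu : ℝ} (hmu : 0 ≤ mu)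
    (h : Tendsto (fun δ : ℝ => ω δ / (√δ : ℂ)) (𝓝[>] 0) (𝓝 ((vb * √mu : ℝ) : ℂ))) :
    (∀ᶠ δ in 𝓝[>] (0 : ℝ), charFn s v vb n ((√δ : ℝ), ω δ / (√δ : ℂ)) = 0) ∧
      Tendsto (fun δ : ℝ => (((√δ : ℝ) : ℂ), ω δ / (√δ : ℂ))) (𝓝[>] 0)
        (𝓝 (0, ((vb * √mu : ℝ) : ℂ))) ∧
      (chainState s mu (n + 1)).2 = 0 := by
  have hzero : ∀ᶠ δ in 𝓝[>] (0 : ℝ), charFn s v vb n ((√δ : ℝ), ω δ / (√δ : ℂ)) = 0 := by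
    filter_upwards [hω.exists_mode, self_mem_nhdsWithin] with δ hδ hδ0
    obtain ⟨u, hu0, hu⟩ := hδ
    have hne : ((√δ : ℝ) : ℂ) ≠ 0 := by
      exact_mod_cast (Real.sqrt_pos.2 hδ0).ne'
    refine charFn_eq_zero_of_isSolution hs hδ0 ?_ hu0
    rwa [mul_div_cancel₀ _ hne]
  have hsqrt : Tendsto (fun δ : ℝ => ((√δ : ℝ) : ℂ)) (𝓝[>] 0) (𝓝 0) := by
    have : ContinuousAt (fun δ : ℝ => ((√δ : ℝ) : ℂ)) 0 :=
      (Complex.continuous_ofReal.comp Real.continuous_sqrt).continuousAt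
    simpa using this.tendsto.mono_left nhdsWithin_le_nhds
  have hpair := hsqrt.prodMk_nhds h
  refine ⟨hzero, hpair, ?_⟩
  have hlim := ((contDiff_charFn s v vb n).continuous.tendsto _).comp hpair
  have h0 : charFn s v vb n (0, ((vb * √mu : ℝ) : ℂ)) = 0 := by
    refine tendsto_nhds_unique hlim (tendsto_const_nhds.congr' ?_)
    filter_upwards [hzero] with δ hδ using hδ.symm
  have hl : (((vb * √mu : ℝ) : ℂ) / vb) ^ 2 = (mu : ℂ) := by
    have : (vb : ℂ) ≠ 0 := by exact_mod_cast hvb.ne'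
    rw [Complex.ofReal_mul, mul_div_cancel_left₀ _ this, ofReal_sqrt_sq hmu]
  rw [charFn_zero, hl, chainState_ofReal] at h0
  exact Complex.ofReal_eq_zero.1 h0

/-- Eigenvalues of the capacitance matrix are simple zeros of the characteristic function at zero
contrast, by the discrete Green identity. -/
lemma exists_hasDerivAt_charFn (hvb : 0 < vb) {n : ℕ} {lam : ℝ} (hlam : 0 < lam)
    (h : (chainState s lam (n + 1)).2 = 0) :
    ∃ d ≠ 0, HasDerivAt (fun ζ => charFn s v vb n (0, ζ)) d ((vb * √lam : ℝ) : ℂ) := by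
  have hvb' : (vb : ℂ) ≠ 0 := by exact_mod_cast hvb.ne'
  have hl : (((vb * √lam : ℝ) : ℂ) / vb) ^ 2 = (lam : ℂ) := by
    rw [Complex.ofReal_mul, mul_div_cancel_left₀ _ hvb', ofReal_sqrt_sq hlam.le]
  obtain ⟨a', y', -, hy, hW⟩ :=
    exists_hasDerivAt_chainState (fun i => (s i : ℂ)) (lam : ℂ) (n + 1)
  have hpow : HasDerivAt (fun ζ : ℂ => (ζ / vb) ^ 2)
      (2 * (((vb * √lam : ℝ) : ℂ) / vb) * (1 / vb)) ((vb * √lam : ℝ) : ℂ) := by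
    simpa using ((hasDerivAt_id ((vb * √lam : ℝ) : ℂ)).div_const (vb : ℂ)).fun_pow 2
  rw [← hl] at hy
  have hcomp := HasDerivAt.comp ((vb * √lam : ℝ) : ℂ) (h := fun ζ : ℂ => (ζ / vb) ^ 2)
    (h₂ := fun l => (chainState (fun i => (s i : ℂ)) l (n + 1)).2) hy hpow
  refine ⟨_, ?_, hcomp.congr_of_eventuallyEq (Eventually.of_forall fun ζ => charFn_zero s v vb n ζ)⟩
  refine mul_ne_zero ?_ ?_
  · rintro rfl
    have hsum : (∑ j ∈ Finset.range (n + 1), (chainState s lam j).1 ^ 2 : ℝ) = 0 := by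
      simp only [chainState_ofReal, h, zero_mul, Complex.ofReal_zero, sub_self] at hW
      have : (∑ j ∈ Finset.range (n + 1), ((chainState s lam j).1 : ℂ) ^ 2) = 0 := by
        rw [← neg_eq_zero, ← hW]
      exact_mod_cast this
    rw [Finset.sum_eq_zero_iff_of_nonneg fun _ _ => sq_nonneg _] at hsum
    simpa using hsum 0 (by simp)
  · have : ((√lam : ℝ) : ℂ) ≠ 0 := by exact_mod_cast (Real.sqrt_pos.2 hlam).ne'
    rw [Complex.ofReal_mul, mul_div_cancel_left₀ _ hvb']
    refine mul_ne_zero (mul_ne_zero two_ne_zero this) (one_div_ne_zero hvb')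

/-- In the limit of small contrast, the solution inside the resonators converges uniformly to the
constants given by the eigenvector of the capacitance matrix. -/
lemma eventually_norm_wave_sub_lt (hvb : 0 < vb) {lam : ℝ} (hlam : 0 < lam) (n : ℕ) {η : ℝ}
    (hη : 0 < η) : ∀ᶠ p in 𝓝 ((0 : ℂ), ((vb * √lam : ℝ) : ℂ)), ∀ i ∈ Finset.range n,
      ∀ t ∈ Icc (0 : ℝ) 1, ‖wave (p.1 * p.2 / vb) (scaledEntry s v vb i p).1
        (p.1 ^ 2 * (scaledEntry s v vb i p).2) t - ((chainState s lam i).1 : ℂ)‖ < η := by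
  have hl : (((vb * √lam : ℝ) : ℂ) / vb) ^ 2 = (lam : ℂ) := by
    have : (vb : ℂ) ≠ 0 := by exact_mod_cast hvb.ne'
    rw [Complex.ofReal_mul, mul_div_cancel_left₀ _ this, ofReal_sqrt_sq hlam.le]
  rw [Filter.eventually_all_finset]
  intro i _
  apply isCompact_Icc.eventually_forall_of_forall_eventually
  intro t _
  obtain ⟨⟨h1, h2⟩, -⟩ := contDiff_scaled s v vb i
  have c1 := h1.continuous
  have c2 := h2.continuous
  have c3 := contDiff_csinc.continuous
  have hcont : Continuous fun z : (ℂ × ℂ) × ℝ => ‖wave (z.1.1 * z.1.2 / vb)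
      (scaledEntry s v vb i z.1).1 (z.1.1 ^ 2 * (scaledEntry s v vb i z.1).2) z.2
        - ((chainState s lam i).1 : ℂ)‖ := by
    have hk : Continuous fun z : (ℂ × ℂ) × ℝ => z.1.1 * z.1.2 / (vb : ℂ) * (z.2 : ℂ) :=
      (((continuous_fst.comp continuous_fst).mul (continuous_snd.comp continuous_fst)).div_const
        _).mul (Complex.continuous_ofReal.comp continuous_snd)
    unfold wave
    exact (((c1.comp continuous_fst).mul (Complex.continuous_cos.comp hk)).add
      ((((continuous_fst.comp continuous_fst).pow 2).mul (c2.comp continuous_fst)).mul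
        ((Complex.continuous_ofReal.comp continuous_snd).mul (c3.comp hk)))).sub
        continuous_const |>.norm
  have hlt := hcont.tendsto (((0 : ℂ), ((vb * √lam : ℝ) : ℂ)), t)
  refine hlt.eventually (gt_mem_nhds ?_)
  simp only [scaledEntry_zero, hl, chainState_ofReal]
  simpa [wave] using hη

end

/-- Every positive eigenvalue of the capacitance matrix is the leading order of exactly one
subwavelength eigenfrequency, whose modes are, for small contrast, nearly constant in each
resonator. -/
lemma exists_eigenfrequency {s : ℕ → ℝ} (hs : ∀ i, 0 < s i) (v : ℝ) {vb : ℝ} (hvb : 0 < vb)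
    {n : ℕ} {lam : ℝ} (hlam : 0 < lam) (h : (chainState s lam (n + 1)).2 = 0) :
    ∃ ω : ℝ → ℂ, IsSubwavelengthEigenfrequency s (n + 1) v vb ω ∧
      (fun δ : ℝ => ω δ - (leadingFrequency vb δ lam : ℂ)) =O[𝓝[>] 0] (fun δ : ℝ => δ) ∧
      (∀ ω' : ℝ → ℂ, IsSubwavelengthEigenfrequency s (n + 1) v vb ω' →
        Tendsto (fun δ : ℝ => ω' δ / (√δ : ℂ)) (𝓝[>] 0) (𝓝 ((vb * √lam : ℝ) : ℂ)) →
        ω' =ᶠ[𝓝[>] 0] ω) ∧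
      ∀ η > 0, ∀ᶠ δ in 𝓝[>] (0 : ℝ), ∃ u : ℝ → ℂ, u ≠ 0 ∧
        IsSolution s (n + 1) v vb δ (ω δ) u ∧
        (∀ w : ℝ → ℂ, IsSolution s (n + 1) v vb δ (ω δ) w → ∃ c : ℂ, w = c • u) ∧
        ∀ i < n + 1, ∀ x ∈ Ioo (leftEnd s (i + 1)) (rightEnd s (i + 1)),
          ‖u x - ((chainState s lam i).1 : ℂ)‖ < η := by
  set ζ₀ : ℂ := ((vb * √lam : ℝ) : ℂ) with hζ₀
  have hl : (ζ₀ / vb) ^ 2 = (lam : ℂ) := by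
    have : (vb : ℂ) ≠ 0 := by exact_mod_cast hvb.ne'
    rw [hζ₀, Complex.ofReal_mul, mul_div_cancel_left₀ _ this, ofReal_sqrt_sq hlam.le]
  have h0 : charFn s v vb n (0, ζ₀) = 0 := by
    rw [charFn_zero, hl, chainState_ofReal, h, Complex.ofReal_zero]
  obtain ⟨d, hd0, hd⟩ := exists_hasDerivAt_charFn (v := v) hvb hlam h
  obtain ⟨ψ, hψ0, hψd, hψG, hψu⟩ :=
    exists_implicit_of_hasDerivAt (contDiff_charFn s v vb n) h0 hd hd0
  have hsqrt : Tendsto (fun δ : ℝ => ((√δ : ℝ) : ℂ)) (𝓝[>] 0) (𝓝 0) := by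
    have : ContinuousAt (fun δ : ℝ => ((√δ : ℝ) : ℂ)) 0 :=
      (Complex.continuous_ofReal.comp Real.continuous_sqrt).continuousAt
    simpa using this.tendsto.mono_left nhdsWithin_le_nhds
  have hψ : Tendsto (fun δ : ℝ => ψ ((√δ : ℝ) : ℂ)) (𝓝[>] 0) (𝓝 ζ₀) := by
    have := hψd.continuousAt.tendsto
    rw [hψ0] at this
    exact this.comp hsqrt
  have hzero : ∀ᶠ δ in 𝓝[>] (0 : ℝ), charFn s v vb n ((√δ : ℝ), ψ ((√δ : ℝ) : ℂ)) = 0 :=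
    hsqrt.eventually hψG
  have hsol : ∀ᶠ δ in 𝓝[>] (0 : ℝ), IsSolution s (n + 1) v vb δ ((√δ : ℝ) * ψ ((√δ : ℝ) : ℂ))
      (shotMode s δ ((√δ : ℝ) * ψ ((√δ : ℝ) : ℂ) / vb) ((√δ : ℝ) * ψ ((√δ : ℝ) : ℂ) / v)
        ((ψ ((√δ : ℝ) : ℂ) / vb) ^ 2) (n + 1)) := by
    filter_upwards [hzero, self_mem_nhdsWithin] with δ hδ hδ0
    exact isSolution_shotMode hs (scaled_wavenumber hδ0 _) ((charFn_eq_zero_iff hδ0 n _).1 hδ)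
  have hne : ∀ δ : ℝ, shotMode s δ ((√δ : ℝ) * ψ ((√δ : ℝ) : ℂ) / vb)
      ((√δ : ℝ) * ψ ((√δ : ℝ) : ℂ) / v) ((ψ ((√δ : ℝ) : ℂ) / vb) ^ 2) (n + 1) ≠ 0 := by
    intro δ h0
    have := congrFun h0 0
    rw [shotMode_zero hs] at this
    simp at this
  refine ⟨fun δ => ((√δ : ℝ) : ℂ) * ψ ((√δ : ℝ) : ℂ), ⟨?_, ?_, ?_⟩, ?_, ?_, ?_⟩
  · simpa using hsqrt.mul hψ
  · have hpos : 0 < ζ₀.re := by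
      rw [hζ₀, Complex.ofReal_re]
      exact mul_pos hvb (Real.sqrt_pos.2 hlam)
    have hre := (Complex.continuous_re.tendsto _).comp hψ
    filter_upwards [hre.eventually (lt_mem_nhds hpos)] with δ hδ
    rw [Complex.re_ofReal_mul]
    exact mul_nonneg (Real.sqrt_nonneg _) (le_of_lt hδ)
  · filter_upwards [hsol] with δ hδ using ⟨_, hne δ, hδ⟩
  · have hO : (fun δ : ℝ => ψ ((√δ : ℝ) : ℂ) - ζ₀) =O[𝓝[>] 0] fun δ : ℝ => ((√δ : ℝ) : ℂ) := by
      have := hψd.isBigO_sub.comp_tendsto hsqrt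
      simpa [Function.comp_def, hψ0] using this
    have hO2 := (Asymptotics.isBigO_refl (fun δ : ℝ => ((√δ : ℝ) : ℂ)) (𝓝[>] 0)).mul hO
    have hO3 : (fun δ : ℝ => ((√δ : ℝ) : ℂ) * ((√δ : ℝ) : ℂ)) =O[𝓝[>] 0] fun δ : ℝ => δ := by
      refine Asymptotics.IsBigO.of_bound 1 ?_
      filter_upwards [self_mem_nhdsWithin] with δ hδ
      rw [← pow_two, ofReal_sqrt_sq (le_of_lt hδ), one_mul, Complex.norm_real]
    refine (hO2.trans hO3).congr' ?_ EventuallyEq.rfl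
    filter_upwards [self_mem_nhdsWithin] with δ hδ
    rw [leadingFrequency, Real.sqrt_mul (le_of_lt hδ), hζ₀]
    push_cast
    ring
  · intro ω' hω' hlim
    obtain ⟨hz, hpair, -⟩ := chainState_eq_zero_of_tendsto hs hvb hω' hlam.le hlim
    filter_upwards [hz, hpair.eventually hψu, self_mem_nhdsWithin] with δ h1 h2 hδ
    have hne : ((√δ : ℝ) : ℂ) ≠ 0 := by
      exact_mod_cast (Real.sqrt_pos.2 hδ).ne'
    rw [h2 h1, mul_div_cancel₀ _ hne]
  · intro η hη
    filter_upwards [hsol, (hsqrt.prodMk_nhds hψ).eventually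
      (eventually_norm_wave_sub_lt (s := s) (v := v) hvb hlam (n + 1) hη),
      self_mem_nhdsWithin] with δ h1 h2 hδ
    refine ⟨_, hne δ, h1, fun w hw => ⟨_, (hw.eq_smul_shotMode hs (ne_of_gt hδ)
      (scaled_wavenumber hδ _)).1⟩, fun i hi x hx => ?_⟩
    have h3 := h2 i (Finset.mem_range.2 hi) (x - leftEnd s (i + 1))
      ⟨by linarith [hx.1], by have := hx.2; unfold rightEnd at this; linarith⟩
    rw [shotMode_eq_wave hs hi x hx]
    simpa only [scaledEntry, ofReal_sqrt_sq (le_of_lt hδ)] using h3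

/-! ### Localisation and convergence -/

lemma abs_leftEnd_sub_le {s : ℕ → ℝ} {S : ℝ} (hs : ∀ i, 0 < s i) (hS : ∀ i, s i ≤ S) (i j : ℕ) :
    |leftEnd s (i + 1) - leftEnd s (j + 1)| ≤ (1 + S) * |(i : ℝ) - j| := by
  wlog hij : i ≤ j generalizing i j
  · rw [abs_sub_comm, abs_sub_comm (i : ℝ)]
    exact this j i (by omega)
  have hij' : (i : ℝ) ≤ j := by exact_mod_cast hij
  rw [abs_of_nonpos (by linarith [leftEnd_mono hs (show i + 1 ≤ j + 1 by omega)]),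
    abs_of_nonpos (by linarith)]
  induction j, hij using Nat.le_induction with
  | base => simp
  | succ j hij ih =>
    have := ih (by exact_mod_cast hij)
    have h1 := hS (j + 1)
    rw [leftEnd_succ_succ, rightEnd]
    push_cast
    linarith

lemma exp_neg_le_of_mem_resonator {s₁ s₂ κ : ℝ} (hs₁ : 0 < s₁) (hs₂ : s₁ < s₂) (hκ : 0 ≤ κ)
    {m i : ℕ} {x : ℝ} (hx : x ∈ Ioo (leftEnd (defectSpacing m s₁ s₂) (i + 1))
      (rightEnd (defectSpacing m s₁ s₂) (i + 1))) :
    Real.exp (-κ * |(i : ℝ) - 2 * m|)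
      ≤ Real.exp κ * Real.exp (-(κ / (1 + s₂)) * |x - interfacePoint m s₁ s₂|) := by
  have h2 : 0 < s₂ := hs₁.trans hs₂
  have h := abs_leftEnd_sub_le (defectSpacing_pos hs₁ h2 m) (defectSpacing_le hs₂.le m) i (2 * m)
  push_cast at h
  have hx2 := hx.2
  unfold rightEnd at hx2
  have hd : |x - interfacePoint m s₁ s₂| ≤ (1 + s₂) * |(i : ℝ) - 2 * m| + 1 := by
    unfold interfacePoint
    rw [abs_le] at h ⊢
    constructor <;> linarith [hx.1, h.1, h.2]
  rw [← Real.exp_add]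
  apply Real.exp_le_exp.2
  have h3 : κ / (1 + s₂) * |x - interfacePoint m s₁ s₂|
      ≤ κ / (1 + s₂) * ((1 + s₂) * |(i : ℝ) - 2 * m| + 1) :=
    mul_le_mul_of_nonneg_left hd (by positivity)
  have h4 : κ / (1 + s₂) * ((1 + s₂) * |(i : ℝ) - 2 * m| + 1)
      = κ * |(i : ℝ) - 2 * m| + κ / (1 + s₂) := by
    field_simp
  have h5 : κ / (1 + s₂) ≤ κ := div_le_self hκ (by linarith)
  linarith

/-- A function that is close to an exponentially localised vector in each resonator is localised;
the closeness has to be of the size of the smallest bound on the entries of the vector. -/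
lemma isLocalisedAt_of_close {s₁ s₂ κ : ℝ} (hs₁ : 0 < s₁) (hs₂ : s₁ < s₂) (hκ : 0 ≤ κ) {m : ℕ}
    {a : ℕ → ℝ} (ha : ∀ i ≤ 4 * m, |a i| ≤ Real.exp κ * Real.exp (-κ * |(i : ℝ) - 2 * m|)
      * |a (2 * m)|) {η : ℝ} (hη1 : η ≤ |a (2 * m)| / 2)
    (hη2 : η ≤ Real.exp κ * Real.exp (-κ * (2 * m)) * |a (2 * m)|) {u : ℝ → ℂ}
    (hu : ∀ i < 4 * m + 1, ∀ x ∈ Ioo (leftEnd (defectSpacing m s₁ s₂) (i + 1))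
      (rightEnd (defectSpacing m s₁ s₂) (i + 1)), ‖u x - (a i : ℂ)‖ < η) :
    IsLocalisedAt (4 * Real.exp (2 * κ)) (κ / (1 + s₂)) (interfacePoint m s₁ s₂)
      (resonators (defectSpacing m s₁ s₂) (4 * m + 1)) u := by
  intro x hx
  obtain ⟨j, hj, hx⟩ := mem_resonators.1 hx
  obtain ⟨i, rfl⟩ : ∃ i, j = i + 1 := ⟨j - 1, by omega⟩
  have hc := hu (2 * m) (by omega) (interfacePoint m s₁ s₂) (by
    unfold interfacePoint rightEnd
    constructor <;> linarith)
  set x₀ := interfacePoint m s₁ s₂ with hx₀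
  have hcenter : |a (2 * m)| ≤ 2 * ‖u x₀‖ := by
    have h1 := norm_sub_norm_le (a (2 * m) : ℂ) (u x₀)
    rw [norm_sub_rev, Complex.norm_real, Real.norm_eq_abs] at h1
    linarith
  have h1 := norm_sub_norm_le (u x) (a i : ℂ)
  have h2 := hu i (by omega) x hx
  rw [Complex.norm_real, Real.norm_eq_abs] at h1
  have hi : |(i : ℝ) - 2 * m| ≤ 2 * m := by
    have : (i : ℝ) ≤ 4 * m := by
      have : i ≤ 4 * m := by omega
      exact_mod_cast this
    rw [abs_le]
    constructor <;> linarith [(Nat.cast_nonneg i : (0 : ℝ) ≤ i)]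
  have h3 : Real.exp (-κ * (2 * m)) ≤ Real.exp (-κ * |(i : ℝ) - 2 * m|) := by
    apply Real.exp_le_exp.2
    nlinarith
  have h4 : η ≤ Real.exp κ * Real.exp (-κ * |(i : ℝ) - 2 * m|) * |a (2 * m)| :=
    hη2.trans (by gcongr)
  have h5 := exp_neg_le_of_mem_resonator hs₁ hs₂ hκ hx
  calc ‖u x‖ ≤ 2 * (Real.exp κ * Real.exp (-κ * |(i : ℝ) - 2 * m|) * |a (2 * m)|) := by
        linarith [ha i (by omega)]
    _ ≤ 2 * (Real.exp κ * (Real.exp κ * Real.exp (-(κ / (1 + s₂)) * |x - x₀|))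
        * (2 * ‖u x₀‖)) := by gcongr
    _ = _ := by
      rw [two_mul κ, Real.exp_add]
      ring

lemma abs_leadingFrequency_sub_le {vb δ a b : ℝ} (hvb : 0 < vb) (hδ : 0 < δ) (ha : 0 < a)
    (hb : 0 ≤ b) : |vb * √(δ * a) - leadingFrequency vb δ b|
      ≤ vb * δ / √(δ * a) * |a - b| := by
  have h1 : 0 < √(δ * a) := Real.sqrt_pos.2 (by positivity)
  have h2 : 0 ≤ √(δ * b) := Real.sqrt_nonneg _
  have h3 : (√(δ * a) - √(δ * b)) * (√(δ * a) + √(δ * b)) = δ * (a - b) := by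
    have e1 := Real.sq_sqrt (show 0 ≤ δ * a by positivity)
    have e2 := Real.sq_sqrt (show 0 ≤ δ * b by positivity)
    linear_combination e1 - e2
  have h4 : |√(δ * a) - √(δ * b)| * √(δ * a) ≤ δ * |a - b| := by
    calc |√(δ * a) - √(δ * b)| * √(δ * a)
        ≤ |√(δ * a) - √(δ * b)| * |√(δ * a) + √(δ * b)| := by
          gcongr
          rw [abs_of_nonneg (by positivity)]
          linarith
      _ = δ * |a - b| := by rw [← abs_mul, h3, abs_mul, abs_of_pos hδ]
  rw [leadingFrequency, ← mul_sub, abs_mul, abs_of_pos hvb, div_mul_eq_mul_div, le_div_iff₀ h1]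
  calc vb * |√(δ * a) - √(δ * b)| * √(δ * a) = vb * (|√(δ * a) - √(δ * b)| * √(δ * a)) := by ring
    _ ≤ vb * (δ * |a - b|) := by gcongr
    _ = _ := by ring

end DimerChain

theorem mainTheorem1 (s₁ s₂ v vb : ℝ) (hs₁ : 0 < s₁) (hs₂ : s₁ < s₂) (hv : 0 < v) (hvb : 0 < vb) :
    ∃ (M : ℕ) (lam : ℕ → ℝ) (ω : ℕ → ℝ → ℂ) (K κ : ℝ), 0 < K ∧ 0 < κ ∧
      (∀ m ≥ M,
        -- the capacitance matrix has exactly one eigenvalue in the gap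
        lam m ∈ bandGap s₁ s₂ ∧
        (∀ μ ∈ bandGap s₁ s₂, Module.End.HasEigenvalue
          (Matrix.toLin' (capacitanceMatrix (defectSpacing m s₁ s₂) (4 * m + 1))) μ ↔ μ = lam m) ∧
        -- its eigenvector is unique up to a factor and is localised at the interface
        Module.finrank ℝ (Module.End.eigenspace
          (Matrix.toLin' (capacitanceMatrix (defectSpacing m s₁ s₂) (4 * m + 1))) (lam m)) = 1 ∧
        (∀ a : Fin (4 * m + 1) → ℝ,
          (capacitanceMatrix (defectSpacing m s₁ s₂) (4 * m + 1)).mulVec a = lam m • a →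
          ∀ i : Fin (4 * m + 1), |a i| ≤
            K * Real.exp (-κ * |((i : ℕ) : ℝ) - 2 * (m : ℝ)|) * |a ⟨2 * m, by omega⟩|) ∧
        -- exactly one subwavelength eigenfrequency lies, at leading order, in the gap
        IsSubwavelengthEigenfrequency (defectSpacing m s₁ s₂) (4 * m + 1) v vb (ω m) ∧
        (fun δ : ℝ => ω m δ - (leadingFrequency vb δ (lam m) : ℂ)) =O[𝓝[>] 0] (fun δ : ℝ => δ) ∧
        (∀ ω' : ℝ → ℂ,
          IsSubwavelengthEigenfrequency (defectSpacing m s₁ s₂) (4 * m + 1) v vb ω' →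
          (∃ μ ∈ bandGap s₁ s₂,
            Tendsto (fun δ : ℝ => ω' δ / (√δ : ℂ)) (𝓝[>] 0) (𝓝 ((vb * √μ : ℝ) : ℂ))) →
          ω' =ᶠ[𝓝[>] 0] ω m) ∧
        -- its mode is unique up to a factor and is localised at the interface
        (∀ᶠ δ in 𝓝[>] (0 : ℝ), ∃ u : ℝ → ℂ, u ≠ 0 ∧
          IsSolution (defectSpacing m s₁ s₂) (4 * m + 1) v vb δ (ω m δ) u ∧
          IsLocalisedAt K κ (interfacePoint m s₁ s₂)
            (resonators (defectSpacing m s₁ s₂) (4 * m + 1)) u ∧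
          ∀ w : ℝ → ℂ, IsSolution (defectSpacing m s₁ s₂) (4 * m + 1) v vb δ (ω m δ) w →
            ∃ c : ℂ, w = c • u)) ∧
      -- exponential convergence of the eigenfrequency, at leading order in the contrast
      (∀ δ : ℝ, 0 < δ →
        Tendsto (fun m => leadingFrequency vb δ (lam m)) atTop (𝓝 (vb * √(δ * (1 / 2 *
          (-√(9 / s₁ ^ 2 - 14 / (s₁ * s₂) + 9 / s₂ ^ 2) + 3 / s₁ + 3 / s₂))))) ∧
        ∃ A > 0, ∃ B > 0, ∀ m ≥ M,
          |vb * √(δ * (1 / 2 *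
            (-√(9 / s₁ ^ 2 - 14 / (s₁ * s₂) + 9 / s₂ ^ 2) + 3 / s₁ + 3 / s₂)))
              - leadingFrequency vb δ (lam m)| < A * Real.exp (-B * (4 * m + 1 : ℝ))) := by
  obtain ⟨M, t, A, ht1, hA, hroot⟩ := exists_matching_root hs₁ hs₂
  have hs₂0 : 0 < s₂ := hs₁.trans hs₂
  -- one dimer spans two resonators, whence the factor `1 / 2`
  set κ : ℝ := Real.log t / 2 with hκdef
  have hκ : 0 < κ := half_pos (Real.log_pos ht1)
  have hexp : Real.exp (2 * κ) = t := by
    rw [hκdef, mul_div_cancel₀ _ two_ne_zero, Real.exp_log (by linarith)]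
  choose! lam hl hmatch htr hdist using hroot
  have hpos := fun m => defectSpacing_pos hs₁ hs₂0 m
  have hl0 := fun m (hm : m ≥ M) => (mul_lt_of_mem_bandGap hs₁ hs₂ (hl m hm)).1
  have hiff : ∀ m ≥ M, ∀ μ ∈ bandGap s₁ s₂,
      (chainState (defectSpacing m s₁ s₂) μ (4 * m + 1)).2 = 0 ↔ μ = lam m := by
    intro m hm μ hμ
    rw [chainState_end_eq_zero_iff _ _ (defectSpacing_symm s₁ s₂ m)
      (chainState_center_ne_zero hs₁ hs₂ hμ m)]
    refine ⟨fun h => center_unique hs₁ hs₂ m hμ (hl m hm) h (hmatch m hm), ?_⟩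
    rintro rfl
    exact hmatch m hm
  have hend := fun m (hm : m ≥ M) => (hiff m hm _ (hl m hm)).2 rfl
  have hω := fun m (hm : m ≥ M) => exists_eigenfrequency (hpos m) v hvb (hl0 m hm) (hend m hm)
  choose! ω h1 h2 h3 h4 using hω
  have hκ' : κ / (1 + s₂) ≤ κ := div_le_self hκ.le (by linarith)
  refine ⟨M, lam, ω, 4 * Real.exp (2 * κ), κ / (1 + s₂), by positivity, by positivity,
    fun m hm => ?_, fun δ hδ => ?_⟩
  · have hdecay : ∀ n ≤ 4 * m, |(chainState (defectSpacing m s₁ s₂) (lam m) n).1|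
        ≤ Real.exp κ * Real.exp (-κ * |(n : ℝ) - 2 * m|)
          * |(chainState (defectSpacing m s₁ s₂) (lam m) (2 * m)).1| := fun n hn =>
      abs_chainState_le_exp hs₁ hs₂ (hl m hm) hκ.le (hexp ▸ htr m hm) (hmatch m hm) hn
    have hc := abs_pos.2 (chainState_center_ne_zero hs₁ hs₂ (hl m hm) m)
    have hN : 0 < 4 * m + 1 := Nat.succ_pos _
    refine ⟨hl m hm, fun μ hμ => (hasEigenvalue_capacitanceMatrix_iff hN (hpos m) μ).trans
      (hiff m hm μ hμ), finrank_eigenspace_capacitanceMatrix hN (hpos m) (hend m hm), ?_,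
      h1 m hm, h2 m hm, ?_, ?_⟩
    · intro a ha i
      rw [capacitanceMatrix_mulVec_eq_smul_iff hN (hpos m)] at ha
      rw [ha.1 i, ha.1 ⟨2 * m, by omega⟩, abs_mul, abs_mul]
      have e1 : Real.exp κ ≤ 4 * Real.exp (2 * κ) := by
        have : Real.exp κ ≤ Real.exp (2 * κ) := Real.exp_le_exp.2 (by linarith)
        linarith [Real.exp_pos (2 * κ)]
      have e2 : Real.exp (-κ * |((i : ℕ) : ℝ) - 2 * m|)
          ≤ Real.exp (-(κ / (1 + s₂)) * |((i : ℕ) : ℝ) - 2 * m|) := by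
        apply Real.exp_le_exp.2
        have := mul_le_mul_of_nonneg_right hκ' (abs_nonneg (((i : ℕ) : ℝ) - 2 * m))
        linarith
      calc _ ≤ |a ⟨0, hN⟩| * (Real.exp κ * Real.exp (-κ * |((i : ℕ) : ℝ) - 2 * m|)
              * |(chainState (defectSpacing m s₁ s₂) (lam m) (2 * m)).1|) := by
            gcongr
            exact hdecay i (by omega)
        _ ≤ |a ⟨0, hN⟩| * (4 * Real.exp (2 * κ)
              * Real.exp (-(κ / (1 + s₂)) * |((i : ℕ) : ℝ) - 2 * m|)
              * |(chainState (defectSpacing m s₁ s₂) (lam m) (2 * m)).1|) := by gcongr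
        _ = _ := by ring
    · rintro ω' hω' ⟨μ, hμ, hlim⟩
      have hμ0 := (mul_lt_of_mem_bandGap hs₁ hs₂ hμ).1
      obtain ⟨-, -, hz⟩ := chainState_eq_zero_of_tendsto (hpos m) hvb hω' hμ0.le hlim
      rw [(hiff m hm μ hμ).1 hz] at hlim
      exact h3 m hm ω' hω' hlim
    · filter_upwards [h4 m hm (min (|(chainState (defectSpacing m s₁ s₂) (lam m) (2 * m)).1| / 2)
        (Real.exp κ * Real.exp (-κ * (2 * m))
          * |(chainState (defectSpacing m s₁ s₂) (lam m) (2 * m)).1|))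
        (lt_min (by positivity) (by positivity))] with δ hδ
      obtain ⟨u, hu0, hu, huniq, hclose⟩ := hδ
      exact ⟨u, hu0, hu, isLocalisedAt_of_close hs₁ hs₂ hκ.le hdecay (min_le_left _ _)
        (min_le_right _ _) hclose, huniq⟩
  · obtain ⟨-, -, hL, -, -⟩ := rootGap_sq_and_bounds hs₁ hs₂
    have hL0 : 0 < interfaceEigenvalue s₁ s₂ := lt_trans (by positivity) hL
    have hbound : ∀ m ≥ M, |vb * √(δ * interfaceEigenvalue s₁ s₂) - leadingFrequency vb δ (lam m)|
        < vb * δ / √(δ * interfaceEigenvalue s₁ s₂) * A * Real.exp (κ / 2)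
          * Real.exp (-(κ / 2) * (4 * m + 1 : ℝ)) := by
      intro m hm
      have hc : 0 < vb * δ / √(δ * interfaceEigenvalue s₁ s₂) := by positivity
      have htm : Real.exp (κ / 2) * Real.exp (-(κ / 2) * (4 * m + 1 : ℝ)) = (t ^ m)⁻¹ := by
        rw [← hexp, ← Real.exp_nat_mul, ← Real.exp_neg, ← Real.exp_add]
        congr 1
        ring
      refine (abs_leadingFrequency_sub_le hvb hδ hL0
        (hl0 m hm).le).trans_lt ?_
      rw [mul_assoc (_ * A), htm, mul_assoc]
      exact mul_lt_mul_of_pos_left (hdist m hm) hc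
    have hAB : 0 < vb * δ / √(δ * interfaceEigenvalue s₁ s₂) * A * Real.exp (κ / 2) := by
      positivity
    refine ⟨?_, _, hAB, κ / 2, by positivity, hbound⟩
    change Tendsto _ _ (𝓝 (vb * √(δ * interfaceEigenvalue s₁ s₂)))
    have hzero : Tendsto (fun m : ℕ => vb * δ / √(δ * interfaceEigenvalue s₁ s₂) * A
        * Real.exp (κ / 2) * Real.exp (-(κ / 2) * (4 * m + 1 : ℝ))) atTop (𝓝 0) := by
      rw [← mul_zero (vb * δ / √(δ * interfaceEigenvalue s₁ s₂) * A * Real.exp (κ / 2))]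
      refine Tendsto.const_mul _ (Real.tendsto_exp_atBot.comp ?_)
      refine Tendsto.const_mul_atTop_of_neg (by linarith) ?_
      exact tendsto_atTop_add_const_right _ _
        (Tendsto.const_mul_atTop (by norm_num) tendsto_natCast_atTop_atTop)
    rw [tendsto_iff_dist_tendsto_zero]
    refine squeeze_zero' (Eventually.of_forall fun _ => dist_nonneg) ?_ hzero
    filter_upwards [eventually_ge_atTop M] with m hm
    rw [dist_comm, Real.dist_eq]
    exact (hbound m hm).le
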